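/- Let $K$ be an arbitrary field. For a finite vertex set $V$ let $S=K[x_v : v\in V]$ carry the standard grading, and for a simplicial complex $\Delta$ on $V$ let $I_\Delta\subset S$ be its Stanley--Reisner ideal, generated by the monomials $\prod_{v\in F}x_v$ with $F\notin\Delta$. Call $\Delta$ *Gröbner-smoothable over $K$* if there are a homogeneous prime ideal $I\subset S$ for which $\operatorname{Proj} S/I$ is a nonempty nonsingular variety (all its local rings are regular) and a monomial order on $S$ such that $\operatorname{in}(I)=I_\Delta$. (a) Let $\Delta=\partial\Delta_1*\dots*\partial\Delta_c$ be the join of the boundaries of finitely many simplices $\Delta_1,\dots,\Delta_c$ of positive dimension. Then $\Delta$ is not Gröbner-smoothable over $K$. (b) Let $\Delta$ be a simplicial complex on $V$ in which every $v\in V$ is a vertex (so that $I_\Delta\subset (x_v : v\in V)^2$). Suppose that $I_\Delta$ is a complete intersection (generated by a regular sequence) and that every variable divides some minimal monomial generator of $I_\Delta$. Then $\Delta$ is not Gröbner-smoothable over $K$. (c) Let $\Delta=\partial\Delta_1*\dots*\partial\Delta_c$ be as in (a), with $c\ge 1$ and $\dim\Delta_i=d_i-1\ge 1$, and suppose that $\Delta$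 has more than two vertices (that is, $\Delta$ is not the boundary of a single $1$-dimensional simplex). Denote by $x_{i1},\dots,x_{id_i}$ the variables of $S$ that correspond to the vertices of $\Delta_i$. Let $\tau$ be any monomial order on $S$, and let $I\subset S$ be an ideal with a reduced Gröbner basis $\{f_1,\dots,f_c\}$ with respect to $\tau$, where each $f_i$ is homogeneous with leading monomial $x_{i1}\cdots x_{id_i}$. Then the point of $\operatorname{Proj} S/I$ at which the $\tau$-largest variable is $1$ and all the other variables are $0$ exists (it lies on $\operatorname{Proj} S/I$), and it is a singular point of $\operatorname{Proj} S/I$: its local ring is not regular. -/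

import Mathlib

open MvPolynomial AlgebraicGeometry
open scoped MonomialOrder

attribute [local instance] MvPolynomial.gradedAlgebra

noncomputable section

namespace GroebnerSmoothing

/-! ### Simplicial complexes (the empty face is implicit in Mathlib's complexes) -/

/-- The boundary of the simplex with vertex set `α`: all proper faces. -/
def simplexBoundary (α : Type*) [Fintype α] : PreAbstractSimplicialComplex α where
  faces := {F | F.Nonempty ∧ F ≠ Finset.univ}
  isRelLowerSet_faces := by
    rintro F ⟨hF, hF'⟩
    refine ⟨hF, fun G hG hne => ⟨hne, ?_⟩⟩
    rintro rfl
    exact hF' (Finset.univ_subset_iff.mp hG)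

/-- The part in the `i`-th block of a set of vertices of a disjoint union. -/
def block {ι : Type*} {α : ι → Type*} (F : Finset (Σ i, α i)) (i : ι) : Finset (α i) :=
  F.preimage (Sigma.mk i) sigma_mk_injective.injOn

/-- The join of a family of simplicial complexes, on the disjoint union of their vertex sets:
a set of vertices is a face when each of its blocks is a (possibly empty) face. -/
def join {ι : Type*} {α : ι → Type*} (D : ∀ i, PreAbstractSimplicialComplex (α i)) :
    PreAbstractSimplicialComplex (Σ i, α i) where
  faces := {F | F.Nonempty ∧ ∀ i, block F i = ∅ ∨ block F i ∈ (D i).faces}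
  isRelLowerSet_faces := by
    rintro F ⟨hF, h⟩
    refine ⟨hF, fun G hG hne => ⟨hne, fun i => ?_⟩⟩
    have hsub : block G i ⊆ block F i := by
      intro a ha
      simp only [block, Finset.mem_preimage] at ha ⊢
      exact hG ha
    rcases Finset.eq_empty_or_nonempty (block G i) with h0 | h0
    · exact Or.inl h0
    · rcases h i with h1 | h1
      · exact absurd (Finset.subset_empty.mp (h1 ▸ hsub)) h0.ne_empty
      · exact Or.inr (((D i).isRelLowerSet_faces h1).2 hsub h0)

/-- The Stanley-Reisner ideal: generated by the square-free monomials of the nonfaces. -/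
def stanleyReisnerIdeal {V : Type*} (K : Type*) [Field K] (D : PreAbstractSimplicialComplex V) :
    Ideal (MvPolynomial V K) :=
  Ideal.span {p | ∃ F : Finset V, F.Nonempty ∧ F ∉ D.faces ∧ p = ∏ v ∈ F, X v}

/-- The minimal nonfaces; their square-free monomials are the minimal generators of the
Stanley-Reisner ideal. -/
def IsMinimalNonface {V : Type*} (D : PreAbstractSimplicialComplex V) (F : Finset V) : Prop :=
  Minimal (fun G : Finset V => G.Nonempty ∧ G ∉ D.faces) F

/-- A complete intersection ideal: one generated by a regular sequence. -/
def IsCompleteIntersection {R : Type*} [CommRing R] (I : Ideal R) : Prop :=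
  ∃ rs : List R, RingTheory.Sequence.IsRegular R rs ∧ Ideal.ofList rs = I

/-! ### Initial ideals and Gröbner bases -/

/-- The initial ideal of `I`, generated by the leading terms of the elements of `I`. -/
def initialIdeal {V K : Type*} [Field K] (m : MonomialOrder V) (I : Ideal (MvPolynomial V K)) :
    Ideal (MvPolynomial V K) :=
  Ideal.span (m.leadingTerm '' (I : Set (MvPolynomial V K)))

/-- `G` is a reduced Gröbner basis of `I`: a Gröbner basis whose elements have leading
coefficient one, and such that no monomial of an element is divisible by the leading monomial of
another element. -/
structure IsReducedGroebnerBasis {V K : Type*} [Field K] (m : MonomialOrder V)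
    (G : Set (MvPolynomial V K)) (I : Ideal (MvPolynomial V K)) : Prop where
  subset : G ⊆ (I : Set (MvPolynomial V K))
  span_leadingTerm : Ideal.span (m.leadingTerm '' G) = initialIdeal m I
  monic : ∀ g ∈ G, m.Monic g
  reduced : ∀ g ∈ G, ∀ g' ∈ G, g ≠ g' → ∀ d ∈ g.support, ¬ m.degree g' ≤ d

/-! ### The projective scheme of a homogeneous ideal -/

/-- The grading of `S ⧸ I` induced by the standard grading of the polynomial ring `S`. -/
def quotientGrading {V K : Type*} [Field K]
    (I : HomogeneousIdeal (homogeneousSubmodule V K)) (n : ℕ) :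
    Submodule K (MvPolynomial V K ⧸ I.toIdeal) :=
  (homogeneousSubmodule V K n).map (Ideal.Quotient.mkₐ K I.toIdeal).toLinearMap

instance quotientGrading_gradedMonoid {V K : Type*} [Field K]
    (I : HomogeneousIdeal (homogeneousSubmodule V K)) :
    SetLike.GradedMonoid (quotientGrading I) where
  one_mem := ⟨1, isHomogeneous_one V K, map_one (Ideal.Quotient.mkₐ K I.toIdeal)⟩
  mul_mem := by
    rintro i j _ _ ⟨a, ha, rfl⟩ ⟨b, hb, rfl⟩
    exact ⟨a * b, IsHomogeneous.mul ha hb, map_mul (Ideal.Quotient.mkₐ K I.toIdeal) a b⟩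

theorem quotientGrading_isInternal {V K : Type*} [Field K]
    (I : HomogeneousIdeal (homogeneousSubmodule V K)) :
    DirectSum.IsInternal (quotientGrading I) := by
  classical
  constructor
  · rw [injective_iff_map_eq_zero]
    intro x hx
    choose s hs hsx using fun i => (x i).2
    have hsum : ∑ i ∈ x.support, s i ∈ I.toIdeal := by
      rw [← Ideal.Quotient.eq_zero_iff_mem, map_sum, ← hx]
      rw [DirectSum.coeAddMonoidHom_eq_dfinsuppSum, DFinsupp.sum]
      exact Finset.sum_congr rfl fun i _ => hsx i
    ext i
    by_cases hi : i ∈ x.support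
    · have h1 := I.isHomogeneous i hsum
      rw [DirectSum.decompose_sum, DFinsupp.finsetSum_apply] at h1
      rw [AddSubmonoidClass.coe_finsetSum, Finset.sum_eq_single i] at h1
      · rw [DirectSum.decompose_of_mem_same _ (hs i)] at h1
        rw [← hsx i]
        exact Ideal.Quotient.eq_zero_iff_mem.mpr h1
      · intro j _ hj
        exact DirectSum.decompose_of_mem_ne _ (hs j) hj
      · exact fun h => absurd hi h
    · simpa using hi
  · intro y
    obtain ⟨p, rfl⟩ := Ideal.Quotient.mk_surjective y
    refine ⟨∑ i ∈ Finset.range (p.totalDegree + 1), DirectSum.of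
      (fun i => quotientGrading I i) i ⟨_, homogeneousComponent i p,
        homogeneousComponent_isHomogeneous i p, rfl⟩, ?_⟩
    rw [map_sum]
    simp only [DirectSum.coeAddMonoidHom_of]
    conv_rhs => rw [← sum_homogeneousComponent p]
    rw [map_sum]
    rfl

instance quotientGrading_gradedAlgebra {V K : Type*} [Field K]
    (I : HomogeneousIdeal (homogeneousSubmodule V K)) : GradedAlgebra (quotientGrading I) where
  toDecomposition := (quotientGrading_isInternal I).chooseDecomposition

/-- The projective scheme `Proj (S ⧸ I)`. -/
def projScheme {V K : Type*} [Field K] (I : HomogeneousIdeal (homogeneousSubmodule V K)) :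
    Scheme :=
  Proj (quotientGrading I)

/-- A point of a scheme is nonsingular when its local ring is a regular local ring. -/
def IsNonsingularAt (Y : Scheme) (y : Y) : Prop :=
  IsRegularLocalRing (Y.presheaf.stalk y)

/-- The homogeneous prime ideal of the polynomial ring that belongs to a point of
`Proj (S ⧸ I)`. -/
def pointIdeal {V K : Type*} [Field K] (I : HomogeneousIdeal (homogeneousSubmodule V K))
    (y : projScheme I) : Ideal (MvPolynomial V K) :=
  Ideal.comap (Ideal.Quotient.mk I.toIdeal)
    (ProjectiveSpectrum.asHomogeneousIdeal (𝒜 := quotientGrading I) y).toIdeal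

/-- `D` is Gröbner-smoothable over `K`: its Stanley-Reisner ideal is the initial ideal, for some
monomial order, of a homogeneous prime ideal that defines a nonsingular (nonempty) projective
variety. -/
def IsGroebnerSmoothable.{u, v, s} {V : Type u} (K : Type v) [Field K]
    (D : PreAbstractSimplicialComplex V) : Prop :=
  ∃ (I : HomogeneousIdeal (homogeneousSubmodule V K)) (m : MonomialOrder.{u, s} V),
    I.toIdeal.IsPrime ∧ Nonempty (projScheme I) ∧
      (∀ y : projScheme I, IsNonsingularAt (projScheme I) y) ∧
      initialIdeal m I.toIdeal = stanleyReisnerIdeal K D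

end GroebnerSmoothing

end

universe uI uA uV uK w

open GroebnerSmoothing

/-! In all three parts the leading monomials are products over disjoint blocks of at least two
variables, and the blocks cover `V`. Forms with such coprime leading monomials are a regular
sequence (`isWeaklyRegular_of_coprime_leading`) and generate `I`, so `I` is a complete intersection.

Let `v₀` be the largest variable. Every form vanishes at its coordinate point, since a pure power of
`X v₀` would exceed the leading monomial. A form of degree `k` that is not in the square of the
ideal of that point has a term `X v₀ ^ (k - 1) * X w`. With more than two variables and a reduced
basis, this cannot happen both for the form whose block contains the smallest variable and for the
form whose block contains the smallest variable outside that block (`exists_mem_coordIdeal_sq`).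

The local ring of `Proj` at the point is the local ring of affine space at a coordinate vector,
modulo `I` and `X v₀ - 1`. It is the quotient by a regular sequence with a member in the square of
the maximal ideal, hence not regular (`not_isRegularLocalRing_of_mem_sq`). This gives (c).

For (a), `exists_reduced_forms` supplies a reduced basis of forms. When there are at most two
variables, either `Proj` is empty or a reducible binary quadric contradicts primality. Part (b)
reduces to the same argument, because the minimal nonfaces of a complete intersection complex are
pairwise disjoint (`disjoint_of_isCompleteIntersection`). -/

/-! ### Quotients of local rings by regular sequences. -/

/-- If `R` were regular, lifts of `dim R` generators of its maximal ideal, together with the members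
of `rs` other than `r₀`, would generate the maximal ideal of `A` modulo its square, hence generate
it by Nakayama. That is fewer than `dim R + rs.length = dim A` generators, which is impossible. -/
theorem not_isRegularLocalRing_of_mem_sq {A R : Type*} [CommRing A] [IsLocalRing A]
    [IsNoetherianRing A] [CommRing R] {rs : List A}
    (hrs : RingTheory.Sequence.IsWeaklyRegular A rs)
    (hmem : ∀ r ∈ rs, r ∈ IsLocalRing.maximalIdeal A)
    {r₀ : A} (hr₀ : r₀ ∈ rs) (hsq : r₀ ∈ IsLocalRing.maximalIdeal A ^ 2)
    (φ : A →+* R) (hφ : Function.Surjective φ) (hker : RingHom.ker φ = Ideal.ofList rs) :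
    ¬ IsRegularLocalRing R := by
  classical
  intro hR
  have hreg := RingTheory.Sequence.IsRegular.of_isWeaklyRegular_of_mem_maximalIdeal A hmem hrs
  have hdim := ringKrullDim_add_length_eq_ringKrullDim_of_isRegular rs hreg
  have hdimR : ringKrullDim (A ⧸ Ideal.ofList rs) = ringKrullDim R := by
    rw [← hker]
    exact ringKrullDim_eq_of_ringEquiv (RingHom.quotientKerEquivOfSurjective hφ)
  rw [hdimR, ← hR.spanFinrank_maximalIdeal] at hdim
  obtain ⟨T, hTcard, hT⟩ := Submodule.FG.exists_span_finset_card_eq_spanFinrank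
    (IsNoetherian.noetherian (IsLocalRing.maximalIdeal R))
  obtain ⟨s, hs⟩ := hφ.hasRightInverse
  have : IsLocalHom φ := hφ.isLocalHom
  set U : Finset A := T.image s ∪ (rs.erase r₀).toFinset with hU
  have hle : IsLocalRing.maximalIdeal A ≤
      Ideal.span (U : Set A) ⊔ IsLocalRing.maximalIdeal A • IsLocalRing.maximalIdeal A := by
    intro a ha
    have h1 : φ a ∈ Ideal.map φ (Ideal.span (U : Set A)) := by
      have h2 : φ a ∈ IsLocalRing.maximalIdeal R := 
        (IsLocalRing.mem_maximalIdeal _).mpr fun hu =>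
          (IsLocalRing.mem_maximalIdeal _).mp ha (isUnit_of_map_unit φ a hu)
      rw [← hT] at h2
      refine Submodule.span_le.mpr ?_ h2
      intro t ht
      rw [← hs t]
      exact Ideal.mem_map_of_mem φ (Ideal.subset_span (by simp [hU]; exact Or.inl ⟨t, ht, rfl⟩))
    obtain ⟨b, hb, hba⟩ := (Ideal.mem_map_iff_of_surjective φ hφ).mp h1
    have h3 : a - b ∈ Ideal.ofList rs := by
      rw [← hker, RingHom.mem_ker, map_sub, hba, sub_self]
    have h4 : Ideal.ofList rs ≤ Ideal.span (U : Set A) ⊔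
        IsLocalRing.maximalIdeal A • IsLocalRing.maximalIdeal A := by
      refine Ideal.span_le.mpr fun r hr => ?_
      by_cases h : r = r₀
      · refine Submodule.mem_sup_right ?_
        rw [smul_eq_mul, ← pow_two, h]
        exact hsq
      · refine Submodule.mem_sup_left (Ideal.subset_span ?_)
        have : r ∈ rs.erase r₀ := (List.mem_erase_of_ne h).mpr hr
        simp [hU, this]
    rw [← sub_add_cancel a b]
    exact add_mem (h4 h3) (Submodule.mem_sup_left hb)
  have hspan : IsLocalRing.maximalIdeal A ≤ Ideal.span (U : Set A) :=
    Submodule.le_of_le_smul_of_le_jacobson_bot (IsNoetherian.noetherian _)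
      (IsLocalRing.maximalIdeal_le_jacobson _) hle
  have hspan' : Ideal.span (U : Set A) = IsLocalRing.maximalIdeal A := by
    refine le_antisymm (Ideal.span_le.mpr fun u hu => ?_) hspan
    simp only [hU, Finset.coe_union, Finset.coe_image, Set.mem_union, Set.mem_image,
      Finset.mem_coe, List.mem_toFinset] at hu
    rcases hu with ⟨t, ht, rfl⟩ | hu
    · have h5 : φ (s t) ∈ IsLocalRing.maximalIdeal R := by
        rw [hs t, ← hT]
        exact Submodule.subset_span ht
      rw [SetLike.mem_coe, IsLocalRing.mem_maximalIdeal, mem_nonunits_iff]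
      exact fun h => (IsLocalRing.mem_maximalIdeal _).mp h5 (h.map φ)
    · exact hmem u (List.mem_of_mem_erase hu)
  have hfin : (IsLocalRing.maximalIdeal A).spanFinrank ≤ U.card := by
    rw [← hspan', ← Set.ncard_coe_finset]
    exact Submodule.spanFinrank_span_le_ncard_of_finite U.finite_toSet
  have hcard : U.card < T.card + rs.length := by
    have h6 : (rs.erase r₀).toFinset.card ≤ rs.length - 1 := by
      rw [← List.length_erase_of_mem hr₀]
      exact List.toFinset_card_le _
    have h7 := List.length_pos_of_mem hr₀
    have h8 : U.card ≤ _ := Finset.card_union_le (T.image s) (rs.erase r₀).toFinset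
    have h9 : (T.image s).card ≤ T.card := Finset.card_image_le
    omega
  have hlt := ringKrullDim_le_spanFinrank_maximalIdeal A
  rw [← hdim, ← hTcard] at hlt
  have : T.card + rs.length ≤ (IsLocalRing.maximalIdeal A).spanFinrank := by exact_mod_cast hlt
  omega

/-! ### Linear maps that preserve leading monomials -/

section LeadingMonomials

variable {σ K : Type*} [Field K] (m : MonomialOrder σ)

/-- `Φ` is unitriangular for the monomial order: the coefficient of `Φ p` at the leading exponent of
`p` receives nothing from the smaller monomials of `p`. -/
theorem injective_of_degree_monomial (Φ : MvPolynomial σ K →ₗ[K] MvPolynomial σ K)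
    (hdeg : ∀ d, m.degree (Φ (monomial d 1)) = d) (hmonic : ∀ d, m.Monic (Φ (monomial d 1))) :
    Function.Injective Φ := by
  classical
  rw [injective_iff_map_eq_zero]
  intro p hp
  by_contra h0
  have h1 : Φ p = ∑ d ∈ p.support, p.coeff d • Φ (monomial d 1) := by
    conv_lhs => rw [p.as_sum, map_sum]
    refine Finset.sum_congr rfl fun d _ => ?_
    rw [← map_smul, smul_monomial, smul_eq_mul, mul_one]
  have h2 : (Φ p).coeff (m.degree p) = p.coeff (m.degree p) := by
    rw [h1, coeff_sum, Finset.sum_eq_single (m.degree p)]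
    · have := (hmonic (m.degree p)).coeff_degree
      rw [hdeg] at this
      rw [coeff_smul, this, smul_eq_mul, mul_one]
    · intro d hd hne
      rw [coeff_smul, m.coeff_eq_zero_of_lt (f := Φ _), smul_zero]
      rw [hdeg]
      exact lt_of_le_of_ne (m.le_degree hd) fun h => hne (m.toSyn.injective h)
    · intro h
      exact absurd (m.degree_mem_support h0) h
  rw [hp, coeff_zero] at h2
  exact h0 (m.coeff_degree_eq_zero_iff.mp h2.symm)

/-- Subtracting the image of the leading term lowers the degree, and monomial orders are
well-founded. -/
theorem surjective_of_degree_monomial (Φ : MvPolynomial σ K →ₗ[K] MvPolynomial σ K)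
    (hdeg : ∀ d, m.degree (Φ (monomial d 1)) = d) (hmonic : ∀ d, m.Monic (Φ (monomial d 1))) :
    Function.Surjective Φ := by
  classical
  suffices ∀ (s : m.syn) (h : MvPolynomial σ K), m.toSyn (m.degree h) = s → ∃ p, Φ p = h from
    fun h => this _ h rfl
  intro s
  induction s using WellFoundedLT.induction with
  | _ s ih =>
    rintro h rfl
    set D := m.degree h with hD
    set h' := h - m.leadingCoeff h • Φ (monomial D 1) with hh'
    have hc : h'.coeff D = 0 := by
      have := (hmonic D).coeff_degree
      rw [hdeg] at this
      rw [hh', coeff_sub, coeff_smul, this, smul_eq_mul, mul_one]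
      exact sub_self _
    -- The zero polynomial has degree `0`, so when `D = 0` there is no strict descent and `h' = 0`
    -- must be kept apart.
    have hle : h' = 0 ∨ m.toSyn (m.degree h') < m.toSyn D := by
      by_cases h0 : h' = 0
      · exact Or.inl h0
      · refine Or.inr (lt_of_le_of_ne ?_ fun he => ?_)
        · refine m.degree_sub_le.trans (sup_le le_rfl ?_)
          refine m.degree_smul_le.trans ?_
          rw [hdeg]
        · rw [← m.toSyn.injective he] at hc
          exact h0 (m.coeff_degree_eq_zero_iff.mp hc)
    obtain ⟨q, hq⟩ : ∃ q, Φ q = h' := by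
      rcases hle with h0 | hlt
      · exact ⟨0, by rw [map_zero, h0]⟩
      · exact ih _ hlt h' rfl
    exact ⟨q + m.leadingCoeff h • monomial D 1, by rw [map_add, map_smul, hq, hh', sub_add_cancel]⟩

end LeadingMonomials

/-! ### Polynomials whose leading monomials are square-free and pairwise coprime -/

section Blocks

variable {σ K ι : Type*} [Field K]

/-- The exponent of the square-free monomial of a set of variables. -/
noncomputable def blockExp (B : Finset σ) : σ →₀ ℕ := ∑ v ∈ B, Finsupp.single v 1

open Classical in
theorem blockExp_apply (B : Finset σ) (v : σ) : blockExp B v = if v ∈ B then 1 else 0 := by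
  simp [blockExp, Finsupp.finsetSum_apply, Finsupp.single_apply]

theorem blockExp_le_iff {B : Finset σ} {d : σ →₀ ℕ} : blockExp B ≤ d ↔ ∀ v ∈ B, d v ≠ 0 := by
  classical
  rw [Finsupp.le_def]
  refine forall_congr' fun v => ?_
  rw [blockExp_apply]
  split_ifs with h <;> simp [h, Nat.one_le_iff_ne_zero]

theorem monomial_blockExp (B : Finset σ) :
    (monomial (blockExp B) 1 : MvPolynomial σ K) = ∏ v ∈ B, X v := by
  rw [blockExp, monomial_sum_one]
  rfl

theorem blockExp_degree (B : Finset σ) : (blockExp B).degree = B.card := by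
  simp [blockExp, map_sum]

/-- The exponent of the highest power of the monomial of a block that divides a monomial. -/
def blockMult (B : Finset σ) (hB : B.Nonempty) (d : σ →₀ ℕ) : ℕ := B.inf' hB d

variable [Fintype ι] {B : ι → Finset σ} (hne : ∀ i, (B i).Nonempty)
  (hdisj : Pairwise fun i j => Disjoint (B i) (B j))

theorem blockMult_add_self (B : Finset σ) (hB : B.Nonempty) (d : σ →₀ ℕ) :
    blockMult B hB (d + blockExp B) = blockMult B hB d + 1 := by
  classical
  unfold blockMult
  apply le_antisymm
  · obtain ⟨v, hv, h⟩ := B.exists_mem_eq_inf' hB d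
    rw [h]
    refine (Finset.inf'_le _ hv).trans ?_
    simp [blockExp_apply, hv]
  · refine Finset.le_inf' _ _ fun v hv => ?_
    simpa [blockExp_apply, hv] using ⟨v, hv, le_rfl⟩

theorem blockMult_add_of_disjoint {B B' : Finset σ} (hB : B.Nonempty) (h : Disjoint B B')
    (d : σ →₀ ℕ) : blockMult B hB (d + blockExp B') = blockMult B hB d := by
  classical
  refine Finset.inf'_congr hB rfl fun v hv => ?_
  simp [blockExp_apply, Finset.disjoint_left.mp h hv]

include hdisj in
theorem sum_blockMult_le (d : σ →₀ ℕ) :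
    ∑ i, blockMult (B i) (hne i) d • blockExp (B i) ≤ d := by
  classical
  intro v
  rw [Finsupp.finsetSum_apply]
  by_cases h : ∃ i, v ∈ B i
  · obtain ⟨i, hi⟩ := h
    rw [Finset.sum_eq_single i]
    · simpa [blockExp_apply, hi, blockMult] using ⟨v, hi, le_rfl⟩
    · intro j _ hj
      simp [blockExp_apply, Finset.disjoint_right.mp (hdisj hj) hi]
    · simp
  · push Not at h
    simp [blockExp_apply, h]

/-- The linear map that replaces the block monomials in each monomial by the polynomials `f i`. -/
noncomputable def blockSubst (f : ι → MvPolynomial σ K) : MvPolynomial σ K →ₗ[K] MvPolynomial σ K :=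
  (basisMonomials σ K).constr K fun d =>
    monomial (d - ∑ i, blockMult (B i) (hne i) d • blockExp (B i)) 1 *
      ∏ i, f i ^ blockMult (B i) (hne i) d

theorem blockSubst_monomial (f : ι → MvPolynomial σ K) (d : σ →₀ ℕ) :
    blockSubst hne f (monomial d 1) =
      monomial (d - ∑ i, blockMult (B i) (hne i) d • blockExp (B i)) 1 *
        ∏ i, f i ^ blockMult (B i) (hne i) d := by
  have := (basisMonomials σ K).constr_basis K (fun d =>
    monomial (d - ∑ i, blockMult (B i) (hne i) d • blockExp (B i)) 1 *
      ∏ i, f i ^ blockMult (B i) (hne i) d) d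
  rwa [coe_basisMonomials] at this

-- `blockSubst` turns multiplication by a block monomial into multiplication by `f i`. As it is also
-- unitriangular, it is a linear bijection that carries ideals of block monomials to ideals
-- generated by the `f i`, so questions about regularity reduce to monomials.
include hdisj in
theorem blockSubst_mul (f : ι → MvPolynomial σ K) (i : ι) (p : MvPolynomial σ K) :
    blockSubst hne f (monomial (blockExp (B i)) 1 * p) = f i * blockSubst hne f p := by
  classical
  suffices (blockSubst hne f) ∘ₗ LinearMap.mulLeft K (monomial (blockExp (B i)) 1) =
      LinearMap.mulLeft K (f i) ∘ₗ blockSubst hne f from LinearMap.congr_fun this p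
  refine (basisMonomials σ K).ext fun d => ?_
  rw [coe_basisMonomials]
  simp only [LinearMap.comp_apply, LinearMap.mulLeft_apply, monomial_mul, one_mul]
  -- Disjointness enters here: multiplying by one block monomial raises only the multiplicity of
  -- that block.
  have hmult : ∀ j, blockMult (B j) (hne j) (blockExp (B i) + d) =
      blockMult (B j) (hne j) d + if j = i then 1 else 0 := by
    intro j
    rw [add_comm]
    split_ifs with h
    · subst h
      exact blockMult_add_self _ _ _
    · exact blockMult_add_of_disjoint _ (hdisj h) _
  rw [blockSubst_monomial, blockSubst_monomial]
  simp only [hmult, add_smul, pow_add, Finset.sum_add_distrib, Finset.prod_mul_distrib, ite_smul,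
    one_smul, zero_smul, pow_ite, pow_one, pow_zero, Finset.sum_ite_eq', Finset.prod_ite_eq',
    Finset.mem_univ, if_true]
  rw [add_comm (∑ x, _), add_tsub_add_eq_tsub_left]
  ring

variable (m : MonomialOrder σ) {f : ι → MvPolynomial σ K}
  (hdeg : ∀ i, m.degree (f i) = blockExp (B i)) (hmonic : ∀ i, m.Monic (f i))

include hdisj hdeg hmonic in
theorem blockSubst_degree (d : σ →₀ ℕ) : m.degree (blockSubst hne f (monomial d 1)) = d := by
  classical
  rw [blockSubst_monomial, m.degree_mul, m.degree_prod]
  · simp only [m.degree_pow, hdeg, m.degree_monomial, one_ne_zero, if_false]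
    exact tsub_add_cancel_of_le (sum_blockMult_le hne hdisj d)
  · exact fun i _ => pow_ne_zero _ (hmonic i).ne_zero
  · simp
  · exact Finset.prod_ne_zero_iff.mpr fun i _ => pow_ne_zero _ (hmonic i).ne_zero

include hmonic in
theorem blockSubst_monic (d : σ →₀ ℕ) : m.Monic (blockSubst hne f (monomial d 1)) := by
  rw [blockSubst_monomial]
  exact m.monic_monomial_one.mul (MonomialOrder.Monic.prod fun i _ => (hmonic i).pow)

include hdisj in
theorem blockSubst_mem_span_iff (s : Set ι) (hinj : Function.Injective (blockSubst hne f))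
    (hsurj : Function.Surjective (blockSubst hne f)) (p : MvPolynomial σ K) :
    blockSubst hne f p ∈ Ideal.span (f '' s) ↔
      p ∈ Ideal.span ((fun i => (monomial (blockExp (B i)) 1 : MvPolynomial σ K)) '' s) := by
  constructor
  · intro h
    obtain ⟨q, hq, hqp⟩ : ∃ q ∈ Ideal.span
        ((fun i => (monomial (blockExp (B i)) 1 : MvPolynomial σ K)) '' s),
        blockSubst hne f q = blockSubst hne f p := by
      refine Submodule.closure_induction
        (p := fun x _ => ∃ q ∈ Ideal.span
          ((fun i => (monomial (blockExp (B i)) 1 : MvPolynomial σ K)) '' s),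
          blockSubst hne f q = x) ⟨0, zero_mem _, map_zero _⟩ ?_ ?_ h
      · rintro _ _ _ _ ⟨q, hq, rfl⟩ ⟨q', hq', rfl⟩
        exact ⟨q + q', add_mem hq hq', map_add _ _ _⟩
      · rintro r _ ⟨i, hi, rfl⟩
        obtain ⟨p, rfl⟩ := hsurj r
        exact ⟨monomial (blockExp (B i)) 1 * p,
          Ideal.mul_mem_right _ _ (Ideal.subset_span ⟨i, hi, rfl⟩), by
            rw [blockSubst_mul hne hdisj, smul_eq_mul, mul_comm]⟩
    rwa [← hinj hqp]
  · intro h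
    refine Submodule.closure_induction
      (p := fun x _ => blockSubst hne f x ∈ Ideal.span (f '' s)) ?_ ?_ ?_ h
    · rw [map_zero]
      exact zero_mem _
    · intro x y _ _ hx hy
      rw [map_add]
      exact add_mem hx hy
    · rintro r _ ⟨i, hi, rfl⟩
      rw [smul_eq_mul, mul_comm, blockSubst_mul hne hdisj]
      exact Ideal.mul_mem_right _ _ (Ideal.subset_span ⟨i, hi, rfl⟩)

-- After transport through `blockSubst` the claim is that a monomial coprime to the generators of a
-- monomial ideal can be cancelled.
include hdisj hdeg hmonic hne in
theorem mem_span_of_mul_mem_span {s : Set ι} {j : ι} (hj : j ∉ s) {h : MvPolynomial σ K}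
    (hh : f j * h ∈ Ideal.span (f '' s)) : h ∈ Ideal.span (f '' s) := by
  classical
  have hd := blockSubst_degree hne hdisj m hdeg hmonic
  have hm := blockSubst_monic hne m hmonic
  have hinj := injective_of_degree_monomial m _ hd hm
  have hsurj := surjective_of_degree_monomial m _ hd hm
  obtain ⟨p, rfl⟩ := hsurj h
  rw [← blockSubst_mul hne hdisj] at hh
  rw [blockSubst_mem_span_iff hne hdisj s hinj hsurj] at hh ⊢
  rw [← Set.image_image (fun d => (monomial d 1 : MvPolynomial σ K)) (fun i => blockExp (B i)),
    mem_ideal_span_monomial_image] at hh ⊢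
  intro d hd
  obtain ⟨_, ⟨i, hi, rfl⟩, hle⟩ := hh (blockExp (B j) + d) (by
    rw [mem_support_iff, coeff_monomial_mul, one_mul]
    exact mem_support_iff.mp hd)
  refine ⟨_, ⟨i, hi, rfl⟩, ?_⟩
  rw [blockExp_le_iff] at hle ⊢
  intro v hv
  have hvj : v ∉ B j :=
    Finset.disjoint_left.mp (hdisj (fun h => hj (h ▸ hi) : i ≠ j)) hv
  simpa [blockExp_apply, hvj] using hle v hv

include hdisj hdeg hmonic hne in
theorem isWeaklyRegular_of_coprime_leading (l : List ι) (hl : l.Nodup) :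
    RingTheory.Sequence.IsWeaklyRegular (MvPolynomial σ K) (l.map f) := by
  rw [RingTheory.Sequence.isWeaklyRegular_iff]
  intro i hi
  rw [isSMulRegular_quotient_iff_mem_of_smul_mem]
  intro h hh
  have hspan : (Ideal.ofList ((l.map f).take i) • ⊤ : Submodule (MvPolynomial σ K) _) =
      Ideal.span (f '' {j | j ∈ l.take i}) := by
    rw [smul_eq_mul, Ideal.mul_top, ← List.map_take, Ideal.ofList]
    congr 1
    ext p
    simp [-List.map_take]
  rw [hspan] at hh ⊢
  rw [List.getElem_map, smul_eq_mul] at hh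
  refine mem_span_of_mul_mem_span hne hdisj m hdeg hmonic ?_ hh
  intro hmem
  rw [Set.mem_ofPred_eq, List.mem_take_iff_getElem] at hmem
  obtain ⟨k, hk, hkk⟩ := hmem
  have := (List.Nodup.getElem_inj_iff hl).mp hkk
  omega

end Blocks

/-- The component of `(X v - 1) * h` in degree `n + 1` is `X v * hₙ - hₙ₊₁`, and in degree `0` it is
`-h₀`. Induction on the degree puts every component of `h` in the ideal. -/
theorem mem_of_X_sub_one_mul_mem {σ K : Type*} [Field K]
    (I : HomogeneousIdeal (homogeneousSubmodule σ K)) (v : σ) {h : MvPolynomial σ K}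
    (hh : (X v - 1) * h ∈ I.toIdeal) : h ∈ I.toIdeal := by
  classical
  have key : ∀ n, (DirectSum.decompose (homogeneousSubmodule σ K) h n : MvPolynomial σ K) ∈
      I.toIdeal := by
    intro n
    have hX : (X v : MvPolynomial σ K) ∈ homogeneousSubmodule σ K 1 := isHomogeneous_X K v
    have hn := I.isHomogeneous n hh
    rw [sub_mul, one_mul, DirectSum.decompose_sub, DFinsupp.sub_apply,
      AddSubgroupClass.coe_sub] at hn
    induction n with
    | zero =>
      rw [DirectSum.coe_decompose_mul_of_left_mem_of_not_le _ hX (by simp), zero_sub] at hn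
      exact neg_mem_iff.mp hn
    | succ n ih =>
      have h1 := ih (by
        have := I.isHomogeneous n hh
        rwa [sub_mul, one_mul, DirectSum.decompose_sub, DFinsupp.sub_apply,
          AddSubgroupClass.coe_sub] at this)
      rw [add_comm n 1] at hn ⊢
      rw [DirectSum.coe_decompose_mul_add_of_left_mem _ hX] at hn
      exact (Submodule.sub_mem_iff_right _ (I.toIdeal.mul_mem_left (X v) h1)).mp hn
  rw [← DirectSum.sum_support_decompose (homogeneousSubmodule σ K) h]
  exact sum_mem fun n _ => key n

/-! ### The local ring of a projective scheme at a coordinate point -/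

section CoordinateIdeals

variable {V K : Type*} [Field K]

variable (K) in
/-- The homogeneous ideal of the coordinate point at which only the variable `v₀` is nonzero. -/
noncomputable abbrev coordIdeal (v₀ : V) : Ideal (MvPolynomial V K) := Ideal.span (X '' {v | v ≠ v₀})

theorem X_notMem_coordIdeal (v₀ : V) : (X v₀ : MvPolynomial V K) ∉ coordIdeal K v₀ := by
  classical
  intro h
  rw [mem_ideal_span_X_image] at h
  obtain ⟨i, hi, h⟩ := h (Finsupp.single v₀ 1) (by
    rw [mem_support_iff, coeff_X, if_pos rfl]
    exact one_ne_zero)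
  exact h (Finsupp.single_eq_of_ne hi)

instance coordIdeal_isPrime (v₀ : V) : (coordIdeal K v₀).IsPrime := by
  classical
  let δ : MvPolynomial V K →ₐ[K] Polynomial K := aeval fun v => if v = v₀ then Polynomial.X else 0
  have hker : RingHom.ker δ = coordIdeal K v₀ := by
    apply le_antisymm
    · intro p hp
      let ε : Polynomial K →ₐ[K] MvPolynomial V K := Polynomial.aeval (X v₀)
      have h : (Ideal.Quotient.mkₐ K (coordIdeal K v₀)).comp (ε.comp δ) =
          Ideal.Quotient.mkₐ K (coordIdeal K v₀) := by
        ext v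
        simp only [AlgHom.comp_apply, δ, aeval_X]
        split_ifs with hv
        · simp [ε, hv]
        · rw [map_zero, map_zero]
          exact ((Ideal.Quotient.eq_zero_iff_mem (I := coordIdeal K v₀)).mpr
            (Ideal.subset_span (Set.mem_image_of_mem X hv))).symm
      have h1 := AlgHom.congr_fun h p
      rw [AlgHom.comp_apply, AlgHom.comp_apply, (RingHom.mem_ker).mp hp, map_zero, map_zero] at h1
      exact Ideal.Quotient.eq_zero_iff_mem.mp h1.symm
    · rw [Ideal.span_le]
      rintro _ ⟨v, hv, rfl⟩
      rw [SetLike.mem_coe, RingHom.mem_ker]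
      simp [δ, show v ≠ v₀ from hv]
  rw [← hker]
  exact RingHom.ker_isPrime _

open Classical in
/-- The evaluation at a coordinate vector. -/
noncomputable def coordEval (v₀ : V) : MvPolynomial V K →+* K := eval (Pi.single v₀ 1)

theorem coordEval_X_self (v₀ : V) : coordEval v₀ (X v₀ : MvPolynomial V K) = 1 := by
  simp [coordEval]

theorem coordEval_X_of_ne {v v₀ : V} (h : v ≠ v₀) :
    coordEval v₀ (X v : MvPolynomial V K) = 0 := by
  simp [coordEval, h]

theorem coordIdeal_le_ker (v₀ : V) : coordIdeal K v₀ ≤ RingHom.ker (coordEval (K := K) v₀) := by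
  rw [Ideal.span_le]
  rintro _ ⟨v, hv, rfl⟩
  exact coordEval_X_of_ne hv

theorem ker_coordEval_le (v₀ : V) :
    RingHom.ker (coordEval (K := K) v₀) ≤ coordIdeal K v₀ ⊔ Ideal.span {X v₀ - 1} := by
  classical
  intro p hp
  set J := coordIdeal K v₀ ⊔ Ideal.span {(X v₀ - 1 : MvPolynomial V K)} with hJ
  have h : (Ideal.Quotient.mk J).comp (C.comp (coordEval v₀)) = Ideal.Quotient.mk J := by
    ext v
    · simp [coordEval]
    · rw [RingHom.comp_apply, RingHom.comp_apply]
      by_cases hv : v = v₀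
      · subst hv
        rw [coordEval_X_self, C_1, eq_comm, Ideal.Quotient.eq]
        exact Submodule.mem_sup_right (Ideal.subset_span rfl)
      · rw [coordEval_X_of_ne hv, C_0, map_zero, eq_comm, Ideal.Quotient.eq_zero_iff_mem]
        exact Submodule.mem_sup_left (Ideal.subset_span ⟨v, hv, rfl⟩)
  have h1 := RingHom.congr_fun h p
  rw [RingHom.comp_apply, RingHom.comp_apply, RingHom.mem_ker.mp hp, map_zero, map_zero] at h1
  exact Ideal.Quotient.eq_zero_iff_mem.mp h1.symm

/-- The value of a form at the coordinate vector is its coefficient at the pure power of `X v₀`;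
every other monomial of the form involves another variable. -/
theorem mem_coordIdeal_of_coordEval_eq_zero {v₀ : V} {n : ℕ} {p : MvPolynomial V K}
    (hp : p.IsHomogeneous n) (h : coordEval v₀ p = 0) : p ∈ coordIdeal K v₀ := by
  classical
  set c := p.coeff (Finsupp.single v₀ n)
  have h1 : p - C c * X v₀ ^ n ∈ coordIdeal K v₀ := by
    rw [mem_ideal_span_X_image]
    intro d hd
    by_contra! hall
    rw [mem_support_iff, coeff_sub, coeff_C_mul, coeff_X_pow] at hd
    split_ifs at hd with hdn
    · rw [← hdn] at hd
      exact hd (by simp [c])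
    · rw [mul_zero, sub_zero] at hd
      have hsingle : d = Finsupp.single v₀ (d v₀) := by
        ext v
        by_cases hv : v = v₀
        · subst hv
          simp
        · rw [Finsupp.single_eq_of_ne hv]
          exact hall v hv
      have hdeg : d.degree = n := by_contra fun h => hd (hp.coeff_eq_zero h)
      rw [hsingle, Finsupp.degree_single] at hdeg
      exact hdn (by rw [hsingle, ← hdeg])
  have h2 := coordIdeal_le_ker v₀ h1
  rw [RingHom.mem_ker, map_sub, h, map_mul, map_pow, coordEval_X_self] at h2
  have hc : c = 0 := by simpa [coordEval] using h2
  rwa [hc, C_0, zero_mul, sub_zero] at h1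

end CoordinateIdeals

/-- This is `θ p = ρ p / ρ (X v₀) ^ n` without division. It is used with `θ` the dehomogenization
and `ρ` the structure map to the localization. -/
theorem map_mul_pow_of_isHomogeneous {V K R : Type*} [Field K] [CommRing R]
    (θ ρ : MvPolynomial V K →+* R) {v₀ : V} (hC : ∀ c, θ (C c) = ρ (C c))
    (hX : ∀ v, θ (X v) * ρ (X v₀) = ρ (X v)) {n : ℕ} {p : MvPolynomial V K}
    (hp : p.IsHomogeneous n) : θ p * ρ (X v₀) ^ n = ρ p := by
  have key : ∀ (d : V →₀ ℕ) (c : K),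
      θ (monomial d c) * ρ (X v₀) ^ d.degree = ρ (monomial d c) := by
    intro d
    induction d using Finsupp.induction_linear with
    | zero => intro c; simpa using hC c
    | add d e hd he =>
      intro c
      have : (monomial (d + e) c : MvPolynomial V K) = monomial d c * monomial e 1 := by
        rw [monomial_mul, mul_one]
      rw [this, map_mul, map_mul, ← hd, ← he, map_add, pow_add]
      ring
    | single v n =>
      intro c
      have : (monomial (Finsupp.single v n) c : MvPolynomial V K) = C c * X v ^ n := by
        rw [X_pow_eq_monomial, C_mul_monomial, mul_one]
      rw [this, map_mul, map_mul, map_pow, map_pow, Finsupp.degree_single, hC, mul_assoc,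
        ← mul_pow, hX]
  rw [p.as_sum, map_sum, map_sum, Finset.sum_mul]
  refine Finset.sum_congr rfl fun d hd => ?_
  have hdeg : d.degree = n := by_contra fun h => mem_support_iff.mp hd (hp.coeff_eq_zero h)
  rw [← hdeg, key]

section CoordinatePoint

variable {V K : Type*} [Field K] (I : HomogeneousIdeal (homogeneousSubmodule V K)) (v₀ : V)

theorem mk_mem_quotientGrading {n : ℕ} {p : MvPolynomial V K} (hp : p.IsHomogeneous n) :
    Ideal.Quotient.mk I.toIdeal p ∈ quotientGrading I n :=
  ⟨p, hp, rfl⟩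

variable {I v₀} in
theorem ker_mk_le (hI : I.toIdeal ≤ coordIdeal K v₀) :
    RingHom.ker (Ideal.Quotient.mk I.toIdeal) ≤ coordIdeal K v₀ := by
  rwa [Ideal.mk_ker]

/-- The coordinate point of `Proj (S ⧸ I)` at which only the variable `v₀` is nonzero. -/
noncomputable def coordPoint (hI : I.toIdeal ≤ coordIdeal K v₀) :
    ProjectiveSpectrum (quotientGrading I) where
  asHomogeneousIdeal := ⟨(coordIdeal K v₀).map (Ideal.Quotient.mk I.toIdeal), by
    rw [Ideal.map_span]
    refine Ideal.homogeneous_span _ _ ?_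
    rintro _ ⟨_, ⟨v, _, rfl⟩, rfl⟩
    exact ⟨1, mk_mem_quotientGrading I (isHomogeneous_X K v)⟩⟩
  isPrime := Ideal.map_isPrime_of_surjective Ideal.Quotient.mk_surjective (ker_mk_le hI)
  not_irrelevant_le h := by
    have h1 : Ideal.Quotient.mk I.toIdeal (X v₀) ∈
        HomogeneousIdeal.irrelevant (quotientGrading I) := by
      rw [HomogeneousIdeal.mem_irrelevant_iff, GradedRing.proj_apply,
        DirectSum.decompose_of_mem_ne _ (mk_mem_quotientGrading I (isHomogeneous_X K v₀))
          one_ne_zero]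
    have h2 : X v₀ ∈ ((coordIdeal K v₀).map (Ideal.Quotient.mk I.toIdeal)).comap
        (Ideal.Quotient.mk I.toIdeal) := h h1
    rw [Ideal.comap_map_of_surjective' _ Ideal.Quotient.mk_surjective,
      sup_eq_left.mpr (ker_mk_le hI)] at h2
    exact X_notMem_coordIdeal v₀ h2

theorem pointIdeal_coordPoint (hI : I.toIdeal ≤ coordIdeal K v₀) :
    pointIdeal I (coordPoint I v₀ hI) = coordIdeal K v₀ := by
  change ((coordIdeal K v₀).map (Ideal.Quotient.mk I.toIdeal)).comap
    (Ideal.Quotient.mk I.toIdeal) = _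
  rw [Ideal.comap_map_of_surjective' _ Ideal.Quotient.mk_surjective,
    sup_eq_left.mpr (ker_mk_le hI)]

variable {I v₀}
variable (y : ProjectiveSpectrum (quotientGrading I)) (hy : pointIdeal I y = coordIdeal K v₀)

include hy in
theorem mk_mem_asHomogeneousIdeal_iff (p : MvPolynomial V K) :
    Ideal.Quotient.mk I.toIdeal p ∈ y.asHomogeneousIdeal.toIdeal ↔ p ∈ coordIdeal K v₀ := by
  rw [← hy]
  rfl

include hy in
theorem mk_X_pow_mem_primeCompl (n : ℕ) :
    Ideal.Quotient.mk I.toIdeal (X v₀ ^ n) ∈ y.asHomogeneousIdeal.toIdeal.primeCompl := by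
  rw [Ideal.mem_primeCompl_iff, mk_mem_asHomogeneousIdeal_iff y hy]
  exact fun h => X_notMem_coordIdeal v₀ (Ideal.IsPrime.mem_of_pow_mem inferInstance n h)

/-- The fraction `p / x ^ n`, with `x` the variable `v₀`, of a form `p` of degree `n`. -/
noncomputable def coordFraction {n : ℕ} {p : MvPolynomial V K} (hp : p.IsHomogeneous n) :
    HomogeneousLocalization.AtPrime (quotientGrading I) y.asHomogeneousIdeal.toIdeal :=
  HomogeneousLocalization.mk ⟨n, ⟨_, mk_mem_quotientGrading I hp⟩,
    ⟨Ideal.Quotient.mk I.toIdeal (X v₀ ^ n),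
      mk_mem_quotientGrading I (by simpa using isHomogeneous_X_pow (R := K) v₀ n)⟩,
    mk_X_pow_mem_primeCompl y hy n⟩

/-- Setting the variable `v₀` equal to `1`, as a map to the local ring at the coordinate point. -/
noncomputable def dehomogenize : MvPolynomial V K →+*
    HomogeneousLocalization.AtPrime (quotientGrading I) y.asHomogeneousIdeal.toIdeal :=
  eval₂Hom ((HomogeneousLocalization.fromZeroRingHom (quotientGrading I) _).comp
    (algebraMap K (quotientGrading I 0))) fun v => coordFraction y hy (isHomogeneous_X K v)

include hy in
theorem dehomogenize_eq_coordFraction {n : ℕ} {p : MvPolynomial V K} (hp : p.IsHomogeneous n) :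
    dehomogenize y hy p = coordFraction y hy hp := by
  set P := y.asHomogeneousIdeal.toIdeal
  let val := algebraMap (HomogeneousLocalization.AtPrime (quotientGrading I) P)
    (Localization P.primeCompl)
  have h := map_mul_pow_of_isHomogeneous (val.comp (dehomogenize y hy))
    ((algebraMap _ (Localization P.primeCompl)).comp (Ideal.Quotient.mk I.toIdeal)) (v₀ := v₀)
    (fun c => ?_) (fun v => ?_) hp
  · apply HomogeneousLocalization.val_injective
    rw [coordFraction, HomogeneousLocalization.val_mk, Localization.mk_eq_mk',
      IsLocalization.eq_mk'_iff_mul_eq]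
    rw [← map_pow] at h
    exact h
  · change (dehomogenize y hy (C c)).val = _
    rw [dehomogenize, coe_eval₂Hom, eval₂_C]
    change Localization.mk _ _ = _
    rw [Localization.mk_eq_mk', IsLocalization.mk'_eq_iff_eq_mul]
    simp
    rfl
  · change (dehomogenize y hy (X v)).val * _ = _
    rw [dehomogenize, coe_eval₂Hom, eval₂_X, coordFraction, HomogeneousLocalization.val_mk,
      Localization.mk_eq_mk']
    simp only [pow_one]
    exact IsLocalization.mk'_spec _ _ _

end CoordinatePoint

section LocalRing

variable {V K : Type*} [Field K] {I : HomogeneousIdeal (homogeneousSubmodule V K)} {v₀ : V}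
  (y : ProjectiveSpectrum (quotientGrading I)) (hy : pointIdeal I y = coordIdeal K v₀)

theorem val_coordFraction {n : ℕ} {p : MvPolynomial V K} (hp : p.IsHomogeneous n) :
    (coordFraction y hy hp).val = IsLocalization.mk' _ (Ideal.Quotient.mk I.toIdeal p)
      ⟨Ideal.Quotient.mk I.toIdeal (X v₀ ^ n), mk_X_pow_mem_primeCompl y hy n⟩ := by
  rw [coordFraction, HomogeneousLocalization.val_mk, Localization.mk_eq_mk']

theorem dehomogenize_X_self : dehomogenize y hy (X v₀) = 1 := by
  rw [dehomogenize_eq_coordFraction y hy (isHomogeneous_X K v₀)]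
  apply HomogeneousLocalization.val_injective
  rw [val_coordFraction, HomogeneousLocalization.val_one]
  simp only [pow_one]
  rw [IsLocalization.mk'_eq_iff_eq_mul, one_mul]

theorem ker_coordEval_le_comap : RingHom.ker (coordEval (K := K) v₀) ≤
    (IsLocalRing.maximalIdeal _).comap (dehomogenize y hy) := by
  refine (ker_coordEval_le v₀).trans (sup_le (Ideal.span_le.mpr ?_) (Ideal.span_le.mpr ?_))
  · rintro _ ⟨v, hv, rfl⟩
    rw [SetLike.mem_coe, Ideal.mem_comap, IsLocalRing.mem_maximalIdeal, mem_nonunits_iff,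
      dehomogenize_eq_coordFraction y hy (isHomogeneous_X K v), ← HomogeneousLocalization.isUnit_iff_isUnit_val,
      val_coordFraction, IsLocalization.AtPrime.isUnit_mk'_iff _ y.asHomogeneousIdeal.toIdeal,
      Ideal.mem_primeCompl_iff, mk_mem_asHomogeneousIdeal_iff y hy, not_not]
    exact Ideal.subset_span (Set.mem_image_of_mem X hv)
  · rintro _ rfl
    rw [SetLike.mem_coe, Ideal.mem_comap, map_sub, dehomogenize_X_self, map_one, sub_self]
    exact zero_mem _

instance ker_coordEval_isPrime : (RingHom.ker (coordEval (K := K) v₀)).IsPrime :=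
  RingHom.ker_isPrime _

/-- Modulo the kernel of `coordEval`, which lands in the maximal ideal, `s` is a nonzero constant.
-/
theorem isUnit_dehomogenize (s : (RingHom.ker (coordEval (K := K) v₀)).primeCompl) :
    IsUnit (dehomogenize y hy s) := by
  obtain ⟨s, hs⟩ := s
  by_contra h
  have h1 : dehomogenize y hy s ∈ IsLocalRing.maximalIdeal _ := h
  have h2 : dehomogenize y hy (s - C (coordEval v₀ s)) ∈ IsLocalRing.maximalIdeal _ := by
    apply ker_coordEval_le_comap y hy
    rw [RingHom.mem_ker, map_sub, sub_eq_zero]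
    simp [coordEval]
  have h3 : dehomogenize y hy (C (coordEval v₀ s)) ∈ IsLocalRing.maximalIdeal _ := by
    rw [map_sub] at h2
    exact (Submodule.sub_mem_iff_right _ h1).mp h2
  refine h3 (IsUnit.map _ (IsUnit.map C (Ne.isUnit fun h0 => hs ?_)))
  exact RingHom.mem_ker.mpr h0

/-- The map from the local ring of affine space at a coordinate vector to the local ring of
`Proj (S ⧸ I)` at the corresponding coordinate point. -/
noncomputable def localDehomogenize :
    Localization.AtPrime (RingHom.ker (coordEval (K := K) v₀)) →+*
      HomogeneousLocalization.AtPrime (quotientGrading I) y.asHomogeneousIdeal.toIdeal :=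
  IsLocalization.lift (isUnit_dehomogenize y hy)

/-- A fraction `a / s` of forms of degree `n` is the quotient of `a / X v₀ ^ n` by `s / X v₀ ^ n`,
and the latter is the image of a unit. -/
theorem localDehomogenize_surjective : Function.Surjective (localDehomogenize y hy) := by
  refine (IsLocalization.lift_surjective_iff _).mpr fun z => ?_
  obtain ⟨⟨n, ⟨a', ha'⟩, ⟨s', hs'⟩, hmem⟩, rfl⟩ := HomogeneousLocalization.mk_surjective z
  obtain ⟨a, ha, rfl⟩ : ∃ a : MvPolynomial V K, a.IsHomogeneous n ∧
    Ideal.Quotient.mk I.toIdeal a = a' := ha'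
  obtain ⟨s, hs, rfl⟩ : ∃ s : MvPolynomial V K, s.IsHomogeneous n ∧
    Ideal.Quotient.mk I.toIdeal s = s' := hs'
  have hsq : s ∉ coordIdeal K v₀ := fun h =>
    hmem ((mk_mem_asHomogeneousIdeal_iff y hy s).mpr h)
  refine ⟨⟨a, ⟨s, fun h => hsq (mem_coordIdeal_of_coordEval_eq_zero hs h)⟩⟩, ?_⟩
  rw [dehomogenize_eq_coordFraction y hy ha, dehomogenize_eq_coordFraction y hy hs]
  apply HomogeneousLocalization.val_injective
  rw [HomogeneousLocalization.val_mul, val_coordFraction, val_coordFraction,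
    HomogeneousLocalization.val_mk, Localization.mk_eq_mk', ← IsLocalization.mk'_mul,
    IsLocalization.mk'_eq_iff_eq]
  simp only [Submonoid.coe_mul]
  congr 1
  ring

theorem le_ker_dehomogenize :
    I.toIdeal ⊔ Ideal.span {X v₀ - 1} ≤ RingHom.ker (dehomogenize y hy) := by
  classical
  refine sup_le (fun p hp => ?_) (Ideal.span_le.mpr ?_)
  · rw [RingHom.mem_ker, ← sum_homogeneousComponent p, map_sum]
    refine Finset.sum_eq_zero fun n _ => ?_
    rw [dehomogenize_eq_coordFraction y hy (homogeneousComponent_isHomogeneous n p)]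
    apply HomogeneousLocalization.val_injective
    rw [val_coordFraction, Ideal.Quotient.eq_zero_iff_mem.mpr
      ((mem_iff_homogeneousComponent_mem I.isHomogeneous p).mp hp n), IsLocalization.mk'_zero,
      HomogeneousLocalization.val_zero]
  · rintro _ rfl
    rw [SetLike.mem_coe, RingHom.mem_ker, map_sub, dehomogenize_X_self, map_one, sub_self]

/-- Homogenizing `p` with powers of `X v₀` changes it only modulo `X v₀ - 1`. The resulting form `P`
is killed modulo `I` by some `s` outside `coordIdeal`; since `I` and `P` are homogeneous, a suitable
component of `s` also works, and it does not vanish at the coordinate vector. -/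
theorem exists_mul_mem_of_dehomogenize_eq_zero {p : MvPolynomial V K}
    (hp : dehomogenize y hy p = 0) : ∃ s ∉ RingHom.ker (coordEval (K := K) v₀),
      s * p ∈ I.toIdeal ⊔ Ideal.span {X v₀ - 1} := by
  classical
  set J := I.toIdeal ⊔ Ideal.span {(X v₀ - 1 : MvPolynomial V K)} with hJ
  set N := p.totalDegree
  set P : MvPolynomial V K :=
    ∑ n ∈ Finset.range (N + 1), homogeneousComponent n p * X v₀ ^ (N - n) with hP
  have hPhom : P.IsHomogeneous N := by
    refine IsHomogeneous.sum _ _ _ fun n hn => ?_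
    have h := (homogeneousComponent_isHomogeneous n p).mul (isHomogeneous_X_pow (R := K) v₀ (N - n))
    rwa [Nat.add_sub_cancel' (Nat.lt_succ_iff.mp (Finset.mem_range.mp hn))] at h
  have hPp : p - P ∈ J := by
    rw [← Ideal.Quotient.eq]
    have hX : Ideal.Quotient.mk J (X v₀) = 1 := by
      rw [← map_one (Ideal.Quotient.mk J), Ideal.Quotient.eq]
      exact Submodule.mem_sup_right (Ideal.subset_span rfl)
    conv_lhs => rw [← sum_homogeneousComponent p]
    rw [hP, map_sum, map_sum]
    refine Finset.sum_congr rfl fun n _ => ?_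
    rw [map_mul, map_pow, hX, one_pow, mul_one]
  have hP0 : dehomogenize y hy P = 0 := by
    have h := le_ker_dehomogenize y hy hPp
    rw [RingHom.mem_ker, map_sub, hp, zero_sub, neg_eq_zero] at h
    exact h
  rw [dehomogenize_eq_coordFraction y hy hPhom, HomogeneousLocalization.ext_iff_val, val_coordFraction,
    HomogeneousLocalization.val_zero, IsLocalization.mk'_eq_zero_iff] at hP0
  obtain ⟨⟨s, hs⟩, hsP⟩ := hP0
  obtain ⟨s, rfl⟩ := Ideal.Quotient.mk_surjective s
  rw [Ideal.mem_primeCompl_iff, mk_mem_asHomogeneousIdeal_iff y hy] at hs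
  obtain ⟨k, hk⟩ : ∃ k, (DirectSum.decompose (homogeneousSubmodule V K) s k : MvPolynomial V K) ∉
      coordIdeal K v₀ := by
    by_contra! hall
    refine hs ?_
    rw [← DirectSum.sum_support_decompose (homogeneousSubmodule V K) s]
    exact sum_mem fun k _ => hall k
  set t := DirectSum.decompose (homogeneousSubmodule V K) s k
  refine ⟨t, fun h => hk (mem_coordIdeal_of_coordEval_eq_zero t.2 h), ?_⟩
  have hmem : s * P ∈ I.toIdeal := by
    rw [← Ideal.Quotient.eq_zero_iff_mem, map_mul]
    exact hsP
  have hcomp : t * P ∈ I.toIdeal := by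
    have h := I.isHomogeneous (k + N) hmem
    rwa [DirectSum.coe_decompose_mul_add_of_right_mem _ hPhom] at h
  have : (t : MvPolynomial V K) * p =
      (t : MvPolynomial V K) * (p - P) + (t : MvPolynomial V K) * P := by ring
  rw [this]
  exact add_mem (J.mul_mem_left _ hPp) (Submodule.mem_sup_left hcomp)

theorem ker_localDehomogenize : RingHom.ker (localDehomogenize y hy) =
    (I.toIdeal ⊔ Ideal.span {X v₀ - 1}).map (algebraMap _ _) := by
  apply le_antisymm
  · intro z hz
    obtain ⟨a, s, rfl⟩ := IsLocalization.exists_mk'_eq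
      (RingHom.ker (coordEval (K := K) v₀)).primeCompl z
    rw [RingHom.mem_ker, localDehomogenize, IsLocalization.lift_mk'_spec, mul_zero] at hz
    obtain ⟨t, ht, hta⟩ := exists_mul_mem_of_dehomogenize_eq_zero y hy hz
    exact (IsLocalization.mk'_mem_map_algebraMap_iff _ _ _ _ _).mpr ⟨t, ht, hta⟩
  · rw [Ideal.map_le_iff_le_comap]
    intro p hp
    rw [Ideal.mem_comap, RingHom.mem_ker, localDehomogenize, IsLocalization.lift_eq]
    exact le_ker_dehomogenize y hy hp

/-- A coordinate point of a projective complete intersection is singular when one of the equations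
vanishes there to second order. -/
theorem not_isNonsingularAt_coordPoint [Finite V] (hI : I.toIdeal ≤ coordIdeal K v₀)
    {l : List (MvPolynomial V K)} (hl : Ideal.ofList l = I.toIdeal)
    (hreg : RingTheory.Sequence.IsWeaklyRegular (MvPolynomial V K) l)
    {f : MvPolynomial V K} (hf : f ∈ l) (hsq : f ∈ coordIdeal K v₀ ^ 2) :
    ¬ IsNonsingularAt (projScheme I) (coordPoint I v₀ hI) := by
  intro hns
  set y : ProjectiveSpectrum (quotientGrading I) := coordPoint I v₀ hI
  have hy : pointIdeal I y = coordIdeal K v₀ := pointIdeal_coordPoint I v₀ hI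
  have : IsRegularLocalRing ((Proj (quotientGrading I)).presheaf.stalk y) := hns
  have hR := IsRegularLocalRing.of_ringEquiv
    (Proj.stalkIso (quotientGrading I) y).commRingCatIsoToRingEquiv
  set q := RingHom.ker (coordEval (K := K) v₀)
  -- The affine chart is kept inside the full affine space, with `X v₀ - 1` as one more equation of
  -- the regular sequence.
  set rs := l ++ [X v₀ - 1]
  have hrs : RingTheory.Sequence.IsWeaklyRegular (MvPolynomial V K) rs := by
    rw [RingTheory.Sequence.isWeaklyRegular_append_iff]
    refine ⟨hreg, (RingTheory.Sequence.isWeaklyRegular_singleton_iff _ _).mpr ?_⟩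
    rw [isSMulRegular_quotient_iff_mem_of_smul_mem, hl, smul_eq_mul, Ideal.mul_top]
    exact fun h hh => mem_of_X_sub_one_mul_mem I v₀ hh
  have hspan : Ideal.ofList rs = I.toIdeal ⊔ Ideal.span {X v₀ - 1} := by
    rw [Ideal.ofList_append, hl, Ideal.ofList_singleton]
  have hmem : ∀ r ∈ rs, r ∈ q := by
    intro r hr
    rcases List.mem_append.mp hr with hr | hr
    · exact coordIdeal_le_ker v₀ (hI (hl ▸ Ideal.subset_span hr))
    · rw [List.mem_singleton.mp hr, RingHom.mem_ker, map_sub, coordEval_X_self, map_one, sub_self]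
  refine not_isRegularLocalRing_of_mem_sq (A := Localization.AtPrime q)
    (hrs.of_isLocalization (Localization.AtPrime q) q.primeCompl) ?_
    (r₀ := algebraMap _ _ f) ?_ ?_
    (localDehomogenize y hy) (localDehomogenize_surjective y hy) ?_ hR
  · intro r hr
    obtain ⟨s, hs, rfl⟩ := List.mem_map.mp hr
    exact (IsLocalization.AtPrime.to_map_mem_maximal_iff _ q s).mpr (hmem s hs)
  · exact List.mem_map_of_mem (List.mem_append_left _ hf)
  · rw [← Localization.AtPrime.map_eq_maximalIdeal, ← Ideal.map_pow]
    exact Ideal.mem_map_of_mem _ (Ideal.pow_right_mono (coordIdeal_le_ker v₀) 2 hsq)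
  · rw [ker_localDehomogenize, ← hspan, Ideal.map_ofList]

end LocalRing

/-! ### Monomials with few factors other than the largest variable. -/

theorem mem_coordIdeal_sq {V K : Type*} [Field K] {v₀ : V} {p : MvPolynomial V K}
    (h : ∀ d ∈ p.support, d v₀ + 2 ≤ d.degree) : p ∈ coordIdeal K v₀ ^ 2 := by
  classical
  rw [p.as_sum]
  refine sum_mem fun d hd => ?_
  have key : ∀ e : V →₀ ℕ, e v₀ < e.degree → ∃ a ≠ v₀, e = Finsupp.single a 1 + (e - Finsupp.single a 1) := by
    intro e he
    obtain ⟨a, ha, hea⟩ : ∃ a ≠ v₀, e a ≠ 0 := by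
      by_contra! hall
      have hsingle : e = Finsupp.single v₀ (e v₀) := by
        ext v
        by_cases hv : v = v₀
        · subst hv
          simp
        · rw [Finsupp.single_eq_of_ne hv]
          exact hall v hv
      rw [hsingle, Finsupp.degree_single] at he
      simp at he
    refine ⟨a, ha, (add_tsub_cancel_of_le ?_).symm⟩
    rw [Finsupp.single_le_iff]
    exact Nat.one_le_iff_ne_zero.mpr hea
  have hdd := h d hd
  obtain ⟨a, ha, hda⟩ := key d (by omega)
  set e := d - Finsupp.single a 1
  have h1 : d v₀ = e v₀ := by
    rw [hda, Finsupp.add_apply, Finsupp.single_eq_of_ne ha.symm, zero_add]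
  have h2 : d.degree = 1 + e.degree := by
    rw [hda, map_add, Finsupp.degree_single]
  obtain ⟨b, hb, heb⟩ := key e (by omega)
  have : ∀ c : K, monomial d c = (X a * X b) * monomial (e - Finsupp.single b 1) c := by
    intro c
    conv_lhs => rw [hda, heb]
    rw [X, X, monomial_mul, monomial_mul, one_mul, one_mul, add_assoc]
  rw [this, pow_two]
  exact Ideal.mul_mem_right _ _ (Ideal.mul_mem_mul
    (Ideal.subset_span (Set.mem_image_of_mem X ha)) (Ideal.subset_span (Set.mem_image_of_mem X hb)))

theorem exists_eq_single_add_single {V : Type*} {v₀ : V} {d : V →₀ ℕ}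
    (hpos : d.degree ≠ 0) (h : d.degree ≤ d v₀ + 1) :
    ∃ v, d = Finsupp.single v₀ (d.degree - 1) + Finsupp.single v 1 := by
  classical
  have hle : Finsupp.single v₀ (d.degree - 1) ≤ d := by
    rw [Finsupp.single_le_iff]
    omega
  have h1 : (d - Finsupp.single v₀ (d.degree - 1)).degree = 1 := by
    have h2 := congrArg Finsupp.degree (add_tsub_cancel_of_le hle)
    rw [map_add, Finsupp.degree_single] at h2
    omega
  set e := d - Finsupp.single v₀ (d.degree - 1) with he
  obtain ⟨v, hv⟩ := Finsupp.ne_iff.mp (fun h0 : e = 0 => by rw [h0, map_zero] at h1; omega)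
  have hve : Finsupp.single v 1 ≤ e := by
    rw [Finsupp.single_le_iff]
    exact Nat.one_le_iff_ne_zero.mpr hv
  have h2 := congrArg Finsupp.degree (add_tsub_cancel_of_le hve)
  rw [map_add, Finsupp.degree_single, h1] at h2
  have h3 : e - Finsupp.single v 1 = 0 := (Finsupp.degree_eq_zero_iff _).mp (by omega)
  refine ⟨v, ?_⟩
  rw [le_antisymm hve (tsub_eq_zero_iff_le.mp h3), he, add_tsub_cancel_of_le hle]

section LargestVariable

variable {V K ι : Type*} [Field K] (m : MonomialOrder V)

/-- Bounding `w` by `v` and each other variable of `B` by `v₀` shows that the leading monomial is at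
most this monomial of `p`; hence they are equal. -/
theorem eq_blockExp_of_mem_support {B : Finset V} {p : MvPolynomial V K}
    (hdeg : m.degree p = blockExp B) {v₀ v w : V}
    (hmax : ∀ v, Finsupp.single v 1 ≼[m] Finsupp.single v₀ 1)
    (hmem : Finsupp.single v₀ (B.card - 1) + Finsupp.single v 1 ∈ p.support) (hw : w ∈ B)
    (hwv : Finsupp.single w 1 ≼[m] Finsupp.single v 1) :
    Finsupp.single v₀ (B.card - 1) + Finsupp.single v 1 = blockExp B := by
  classical
  apply m.toSyn.injective
  apply le_antisymm
  · rw [← hdeg]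
    exact m.le_degree hmem
  · rw [blockExp, ← Finset.sum_erase_add _ _ hw, map_add, map_add]
    refine add_le_add ?_ hwv
    rw [map_sum]
    refine (Finset.sum_le_card_nsmul _ _ _ fun b _ => hmax b).trans ?_
    rw [Finset.card_erase_of_mem hw, ← map_nsmul, Finsupp.smul_single, smul_eq_mul, mul_one]

theorem mem_coordIdeal_of_degree_eq_blockExp {B : Finset V} {p : MvPolynomial V K}
    (hcard : 2 ≤ B.card) (hhom : p.IsHomogeneous B.card) (hdeg : m.degree p = blockExp B) {v₀ : V}
    (hmax : ∀ v, Finsupp.single v 1 ≼[m] Finsupp.single v₀ 1) : p ∈ coordIdeal K v₀ := by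
  classical
  rw [mem_ideal_span_X_image]
  intro d hd
  by_contra! hall
  have hsingle : d = Finsupp.single v₀ (d v₀) := by
    ext v
    by_cases hv : v = v₀
    · subst hv
      simp
    · rw [Finsupp.single_eq_of_ne hv]
      exact hall v hv
  have hddeg : d.degree = B.card := by_contra fun h => mem_support_iff.mp hd (hhom.coeff_eq_zero h)
  have hdc : d v₀ = B.card := by rwa [hsingle, Finsupp.degree_single] at hddeg
  rw [hdc] at hsingle
  have hd' : d = Finsupp.single v₀ (B.card - 1) + Finsupp.single v₀ 1 := by
    rw [hsingle, ← Finsupp.single_add, Nat.sub_add_cancel (by omega)]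
  obtain ⟨w, hw⟩ := Finset.card_pos.mp (by omega : 0 < B.card)
  rw [hd'] at hd
  have := eq_blockExp_of_mem_support m hdeg hmax hd hw (hmax w)
  rw [← hd'] at this
  have h1 := DFunLike.congr_fun this v₀
  rw [blockExp_apply, hdc] at h1
  split_ifs at h1 <;> omega

/-- Among forms with pairwise coprime square-free leading monomials that involve all the variables,
none of which contains a monomial divisible by the leading monomial of another one, some form
vanishes to second order at the coordinate point of the largest variable. -/
theorem exists_mem_coordIdeal_sq [Fintype V] {B : ι → Finset V}
    (hdisj : Pairwise fun i j => Disjoint (B i) (B j)) (hcover : ∀ v, ∃ i, v ∈ B i)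
    (hcard : ∀ i, 2 ≤ (B i).card) (hV : 2 < Fintype.card V) {f : ι → MvPolynomial V K}
    (hhom : ∀ i, (f i).IsHomogeneous (B i).card) (hdeg : ∀ i, m.degree (f i) = blockExp (B i))
    (hred : ∀ i j, i ≠ j → ∀ d ∈ (f i).support, ¬ blockExp (B j) ≤ d) {v₀ : V}
    (hmax : ∀ v, Finsupp.single v 1 ≼[m] Finsupp.single v₀ 1) :
    ∃ j, f j ∈ coordIdeal K v₀ ^ 2 := by
  classical
  have hinj : ∀ {a b : V}, m.toSyn (Finsupp.single a 1) = m.toSyn (Finsupp.single b 1) → a = b :=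
    fun h => Finsupp.single_left_injective one_ne_zero (m.toSyn.injective h)
  have key : ∀ i, f i ∉ coordIdeal K v₀ ^ 2 → ∃ v,
      Finsupp.single v₀ ((B i).card - 1) + Finsupp.single v 1 ∈ (f i).support := by
    intro i hi
    have h1 := mt (mem_coordIdeal_sq (p := f i)) hi
    push Not at h1
    obtain ⟨d, hd, hlt⟩ := h1
    have hddeg : d.degree = (B i).card :=
      by_contra fun h => mem_support_iff.mp hd ((hhom i).coeff_eq_zero h)
    have hc := hcard i
    obtain ⟨v, hv⟩ := exists_eq_single_add_single (v₀ := v₀) (d := d) (by omega) (by omega)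
    rw [hddeg] at hv
    exact ⟨v, hv ▸ hd⟩
  -- `u` is the smallest variable. If the form of its block has a term `X v₀ ^ (k - 1) * X v`, that
  -- term is the square-free leading monomial, so the block is `{v₀, u}` and `k = 2`.
  obtain ⟨u, -, hu⟩ := Finset.exists_min_image Finset.univ
    (fun v => m.toSyn (Finsupp.single v 1)) ⟨v₀, Finset.mem_univ _⟩
  replace hu := fun v => hu v (Finset.mem_univ v)
  obtain ⟨j₀, hj₀⟩ := hcover u
  by_contra! hall
  obtain ⟨v, hv⟩ := key j₀ (hall j₀)
  have heq := eq_blockExp_of_mem_support m (hdeg j₀) hmax hv hj₀ (hu v)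
  have huv₀ : u ≠ v₀ := by
    rintro rfl
    have : Fintype.card V ≤ 1 :=
      Fintype.card_le_one_iff.mpr fun a b => by
        rw [hinj (le_antisymm (hmax a) (hu a)), hinj (le_antisymm (hmax b) (hu b))]
    omega
  have hu1 := DFunLike.congr_fun heq u
  rw [blockExp_apply, if_pos hj₀, Finsupp.add_apply, Finsupp.single_eq_of_ne huv₀, zero_add,
    Finsupp.single_apply] at hu1
  have hvu : v = u := by
    by_contra h
    rw [if_neg h] at hu1
    exact zero_ne_one hu1
  subst hvu
  have hv0 := DFunLike.congr_fun heq v₀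
  rw [blockExp_apply, Finsupp.add_apply, Finsupp.single_eq_same,
    Finsupp.single_eq_of_ne huv₀.symm, add_zero] at hv0
  have hc := hcard j₀
  have hv₀mem : v₀ ∈ B j₀ := by
    by_contra h
    rw [if_neg h] at hv0
    omega
  rw [if_pos hv₀mem] at hv0
  have hB : B j₀ = {v₀, v} := by
    refine (Finset.eq_of_subset_of_card_le ?_ ?_).symm
    · intro x hx
      rcases Finset.mem_insert.mp hx with rfl | hx
      · exact hv₀mem
      · exact Finset.mem_singleton.mp hx ▸ hj₀
    · rw [Finset.card_pair huv₀.symm]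
      omega
  have hrest : (Finset.univ \ B j₀).Nonempty := by
    rw [← Finset.card_pos, Finset.card_sdiff_of_subset (Finset.subset_univ _), Finset.card_univ]
    omega
  -- `u'` is the smallest variable outside that block. In its form, a term `X v₀ ^ (k - 1) * X w`
  -- with `w` outside `{v₀, u}` would be the leading monomial, although `v₀` lies in another block.
  obtain ⟨u', hu'mem, hu'⟩ := Finset.exists_min_image _
    (fun v => m.toSyn (Finsupp.single v 1)) hrest
  rw [Finset.mem_sdiff] at hu'mem
  obtain ⟨j, hj⟩ := hcover u'
  have hjj₀ : j ≠ j₀ := fun h => hu'mem.2 (h ▸ hj)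
  obtain ⟨w, hw⟩ := key j (hall j)
  have hcj := hcard j
  have hwB : w ∈ B j₀ := by
    by_contra hwn
    have h1 := eq_blockExp_of_mem_support m (hdeg j) hmax hw hj
      (hu' w (Finset.mem_sdiff.mpr ⟨Finset.mem_univ _, hwn⟩))
    have h2 := DFunLike.congr_fun h1 v₀
    rw [blockExp_apply, if_neg (Finset.disjoint_right.mp (hdisj hjj₀) hv₀mem), Finsupp.add_apply,
      Finsupp.single_eq_same] at h2
    omega
  rw [hB, Finset.mem_insert, Finset.mem_singleton] at hwB
  rcases hwB with rfl | rfl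
  · have h1 := eq_blockExp_of_mem_support m (hdeg j) hmax hw hj (hmax u')
    have h2 := DFunLike.congr_fun h1 w
    rw [blockExp_apply, if_neg (Finset.disjoint_right.mp (hdisj hjj₀) hv₀mem), Finsupp.add_apply,
      Finsupp.single_eq_same] at h2
    omega
  -- Here `w` is the smallest variable, and the term is divisible by the leading monomial of `f j₀`,
  -- against reducedness.
  · refine hred j j₀ hjj₀ _ hw (blockExp_le_iff.mpr fun x hx => ?_)
    rw [hB, Finset.mem_insert, Finset.mem_singleton] at hx
    rcases hx with rfl | rfl
    · simp
      omega
    · simp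

end LargestVariable

/-! ### Gröbner bases obtained from the initial ideal. -/

section InitialIdeals

variable {V K ι : Type*} [Field K] {m : MonomialOrder V}

theorem exists_le_degree_of_mem {I : Ideal (MvPolynomial V K)} {β : ι → V →₀ ℕ}
    (hin : initialIdeal m I = Ideal.span (Set.range fun i => monomial (β i) 1))
    {p : MvPolynomial V K} (hp : p ∈ I) (h0 : p ≠ 0) : ∃ i, β i ≤ m.degree p := by
  have h1 : m.leadingTerm p ∈ initialIdeal m I := Ideal.subset_span ⟨p, hp, rfl⟩
  rw [hin, Set.range_comp' (fun d => (monomial d 1 : MvPolynomial V K)) β,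
    mem_ideal_span_monomial_image] at h1
  obtain ⟨_, ⟨i, rfl⟩, hi⟩ := h1 (m.degree p) (by
    rw [m.support_leadingTerm' h0]
    exact Finset.mem_singleton_self _)
  exact ⟨i, hi⟩

/-- The remainder of `p ∈ I` on division by `f` lies in `I`; if nonzero, its leading monomial would
be divisible by that of some `f i`. -/
theorem eq_span_of_initialIdeal_eq {I : Ideal (MvPolynomial V K)} {f : ι → MvPolynomial V K}
    (hmem : ∀ i, f i ∈ I) (hmonic : ∀ i, m.Monic (f i))
    (hin : initialIdeal m I = Ideal.span (Set.range fun i => monomial (m.degree (f i)) 1)) :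
    I = Ideal.span (Set.range f) := by
  refine le_antisymm (fun p hp => ?_) (Ideal.span_le.mpr (Set.range_subset_iff.mpr hmem))
  obtain ⟨g, r, hgr, -, hr⟩ := m.div (b := f)
    (fun i => by rw [(hmonic i).leadingCoeff_eq_one]; exact isUnit_one) p
  have hlin : Finsupp.linearCombination (MvPolynomial V K) f g ∈ Ideal.span (Set.range f) :=
    Finsupp.mem_ideal_span_range_iff_exists_finsupp.mpr ⟨g, rfl⟩
  have hrI : r ∈ I := by
    have : r = p - Finsupp.linearCombination (MvPolynomial V K) f g := by rw [hgr]; ring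
    rw [this]
    exact sub_mem hp (Ideal.span_le.mpr (Set.range_subset_iff.mpr hmem) hlin)
  by_cases h0 : r = 0
  · rw [hgr, h0, add_zero]
    exact hlin
  · obtain ⟨i, hi⟩ := exists_le_degree_of_mem hin hrI h0
    exact absurd hi (hr _ (m.degree_mem_support h0) i)

theorem exists_monic_degree_eq {I : Ideal (MvPolynomial V K)} {β : V →₀ ℕ}
    (hin : monomial β 1 ∈ initialIdeal m I) : ∃ p ∈ I, m.Monic p ∧ m.degree p = β := by
  classical
  rw [initialIdeal, m.span_leadingTerm_eq_span_monomial',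
    ← Set.image_image (fun d => (monomial d 1 : MvPolynomial V K)) m.degree,
    mem_ideal_span_monomial_image] at hin
  obtain ⟨_, ⟨p, ⟨hp, hp0⟩, rfl⟩, hle⟩ := hin β (by simp [mem_support_iff])
  have hp0 : p ≠ 0 := hp0
  have hc : (m.leadingCoeff p)⁻¹ ≠ 0 := inv_ne_zero (m.leadingCoeff_ne_zero_iff.mpr hp0)
  refine ⟨monomial (β - m.degree p) (m.leadingCoeff p)⁻¹ * p, I.mul_mem_left _ hp, ?_, ?_⟩
  · rw [MonomialOrder.Monic, m.leadingCoeff_mul, m.leadingCoeff_monomial]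
    exact inv_mul_cancel₀ (m.leadingCoeff_ne_zero_iff.mpr hp0)
  · rw [m.degree_mul ((monomial_eq_zero).not.mpr hc) hp0, m.degree_monomial, if_neg hc,
      tsub_add_cancel_of_le hle]

/-- A homogeneous ideal whose initial ideal is generated by incomparable monomials has a reduced
Gröbner basis of forms with these monomials as leading monomials. -/
theorem exists_reduced_forms (I : HomogeneousIdeal (homogeneousSubmodule V K)) {β : ι → V →₀ ℕ}
    (hβ : ∀ i j, β j ≤ β i → j = i)
    (hin : initialIdeal m I.toIdeal = Ideal.span (Set.range fun i => monomial (β i) 1)) :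
    ∃ f : ι → MvPolynomial V K, (∀ i, f i ∈ I.toIdeal) ∧ (∀ i, m.Monic (f i)) ∧
      (∀ i, m.degree (f i) = β i) ∧ (∀ i, (f i).IsHomogeneous (β i).degree) ∧
      ∀ i j, i ≠ j → ∀ d ∈ (f i).support, ¬ β j ≤ d := by
  classical
  choose g hgI hgmonic hgdeg using fun i => exists_monic_degree_eq (m := m) (I := I.toIdeal)
    (β := β i) (hin ▸ Ideal.subset_span ⟨i, rfl⟩)
  have hred : ∀ i, ∃ p ∈ I.toIdeal, p.coeff (β i) = 1 ∧ p.IsHomogeneous (β i).degree ∧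
      ∀ d ∈ p.support, d ≠ β i → ∀ j, ¬ β j ≤ d := by
    intro i
    obtain ⟨h, r, hhr, -, hr⟩ := m.div (b := g)
      (fun i => by rw [(hgmonic i).leadingCoeff_eq_one]; exact isUnit_one) (monomial (β i) 1)
    simp only [hgdeg] at hr
    have hlin : Finsupp.linearCombination (MvPolynomial V K) g h ∈ I.toIdeal :=
      Ideal.span_le.mpr (Set.range_subset_iff.mpr hgI)
        (Finsupp.mem_ideal_span_range_iff_exists_finsupp.mpr ⟨h, rfl⟩)
    have hlin_eq : Finsupp.linearCombination (MvPolynomial V K) g h = monomial (β i) 1 - r := by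
      rw [hhr]; ring
    have hri : r.coeff (β i) = 0 := by
      by_contra hne
      exact hr _ (mem_support_iff.mpr hne) i le_rfl
    -- A monomial minus its remainder lies in `I`, and so does its component in the degree of the
    -- monomial. Apart from `β i`, only standard monomials occur in it.
    refine ⟨homogeneousComponent (β i).degree (monomial (β i) 1 - r), ?_, ?_,
      homogeneousComponent_isHomogeneous _ _, fun d hd hdi => ?_⟩
    · rw [← hlin_eq]
      exact (mem_iff_homogeneousComponent_mem I.isHomogeneous _).mp hlin _
    · rw [coeff_homogeneousComponent, if_pos rfl, coeff_sub, hri, coeff_monomial, if_pos rfl,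
        sub_zero]
    · rw [mem_support_iff, coeff_homogeneousComponent] at hd
      split_ifs at hd
      · rw [coeff_sub, coeff_monomial, if_neg hdi.symm, zero_sub, neg_ne_zero] at hd
        exact hr d (mem_support_iff.mpr hd)
      · exact absurd rfl hd
  choose f hfI hcoeff hhom hstd using hred
  have hdeg : ∀ i, m.degree (f i) = β i := by
    intro i
    have h0 : f i ≠ 0 := fun h => by simpa [h] using hcoeff i
    by_contra hne
    obtain ⟨j, hj⟩ := exists_le_degree_of_mem hin (hfI i) h0
    exact hstd i _ (m.degree_mem_support h0) hne j hj
  refine ⟨f, hfI, fun i => ?_, hdeg, hhom, fun i j hij d hd hle => ?_⟩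
  · rw [MonomialOrder.Monic, MonomialOrder.leadingCoeff, hdeg, hcoeff]
  · by_cases hdi : d = β i
    · exact hij (hβ i j (hdi ▸ hle)).symm
    · exact hstd i d hd hdi j hle

end InitialIdeals

/-! ### The singular point, and the exclusion of smooth varieties. -/

section Singularity

variable {V K ι : Type*} [Field K] [Fintype V] [Fintype ι] {m : MonomialOrder V}
  {B : ι → Finset V} (hdisj : Pairwise fun i j => Disjoint (B i) (B j))
  (hcover : ∀ v, ∃ i, v ∈ B i) (hcard : ∀ i, 2 ≤ (B i).card)
  (I : HomogeneousIdeal (homogeneousSubmodule V K))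

include hdisj hcover hcard

theorem exists_singular_coordinate_point (hV : 2 < Fintype.card V) {f : ι → MvPolynomial V K}
    (hmem : ∀ i, f i ∈ I.toIdeal) (hmonic : ∀ i, m.Monic (f i))
    (hdeg : ∀ i, m.degree (f i) = blockExp (B i))
    (hin : initialIdeal m I.toIdeal = Ideal.span (Set.range fun i => monomial (blockExp (B i)) 1))
    (hhom : ∀ i, (f i).IsHomogeneous (B i).card)
    (hred : ∀ i j, i ≠ j → ∀ d ∈ (f i).support, ¬ blockExp (B j) ≤ d) {v₀ : V}
    (hmax : ∀ v, Finsupp.single v 1 ≼[m] Finsupp.single v₀ 1) :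
    ∃ y : projScheme I, pointIdeal I y = coordIdeal K v₀ ∧
      ¬ IsNonsingularAt (projScheme I) y := by
  have hspan : I.toIdeal = Ideal.span (Set.range f) :=
    eq_span_of_initialIdeal_eq hmem hmonic (by simpa only [hdeg] using hin)
  have hI : I.toIdeal ≤ coordIdeal K v₀ := by
    rw [hspan, Ideal.span_le]
    rintro _ ⟨i, rfl⟩
    exact mem_coordIdeal_of_degree_eq_blockExp m (hcard i) (hhom i) (hdeg i) hmax
  obtain ⟨j, hj⟩ := exists_mem_coordIdeal_sq m hdisj hcover hcard hV hhom hdeg hred hmax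
  refine ⟨coordPoint I v₀ hI, pointIdeal_coordPoint I v₀ hI,
    not_isNonsingularAt_coordPoint (l := Finset.univ.toList.map f) hI ?_ ?_
      (List.mem_map_of_mem (Finset.mem_toList.mpr (Finset.mem_univ j))) hj⟩
  · rw [hspan, Ideal.ofList]
    congr 1
    ext p
    simp
  · exact isWeaklyRegular_of_coprime_leading
      (fun i => Finset.card_pos.mp (by have := hcard i; omega)) hdisj m hdeg hmonic _
      (Finset.nodup_toList _)

theorem not_smooth_of_initialIdeal_eq (hprime : I.toIdeal.IsPrime) (hne : Nonempty (projScheme I))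
    (hsmooth : ∀ y : projScheme I, IsNonsingularAt (projScheme I) y)
    (hin : initialIdeal m I.toIdeal = Ideal.span (Set.range fun i => monomial (blockExp (B i)) 1)) :
    False := by
  classical
  have hβ : ∀ i j, blockExp (B j) ≤ blockExp (B i) → j = i := by
    intro i j hle
    by_contra hji
    obtain ⟨v, hv⟩ := Finset.card_pos.mp (by have := hcard j; omega : 0 < (B j).card)
    have := blockExp_le_iff.mp hle v hv
    rw [blockExp_apply, if_neg (Finset.disjoint_left.mp (hdisj hji) hv)] at this
    exact this rfl
  obtain ⟨f, hmem, hmonic, hdeg, hhom, hred⟩ := exists_reduced_forms I hβ hin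
  simp only [blockExp_degree] at hhom
  rcases isEmpty_or_nonempty V with hV | hV
  -- Without variables everything has degree zero, so the irrelevant ideal vanishes and `Proj` is
  -- empty.
  · obtain ⟨y⟩ := hne
    change ProjectiveSpectrum (quotientGrading I) at y
    refine y.not_irrelevant_le fun a ha => ?_
    obtain ⟨p, rfl⟩ := Ideal.Quotient.mk_surjective a
    change _ ∈ HomogeneousIdeal.irrelevant (quotientGrading I) at ha
    rw [HomogeneousIdeal.mem_irrelevant_iff, GradedRing.proj_apply,
      DirectSum.decompose_of_mem_same _
        (mk_mem_quotientGrading I (isHomogeneous_of_isEmpty V K p))] at ha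
    rw [ha]
    exact zero_mem _
  · obtain ⟨v₀, -, hv₀⟩ := Finset.exists_max_image Finset.univ
      (fun v => m.toSyn (Finsupp.single v 1)) Finset.univ_nonempty
    replace hv₀ := fun v => hv₀ v (Finset.mem_univ v)
    by_cases hV2 : 2 < Fintype.card V
    · obtain ⟨y, -, hy⟩ := exists_singular_coordinate_point hdisj hcover hcard I hV2 hmem hmonic
        hdeg hin hhom hred hv₀
      exact hy (hsmooth y)
    -- Now `V` has exactly two elements. The quadric `f i` vanishes at the coordinate point, so it
    -- is `X u` times a linear form; the prime ideal contains one of the factors, but its nonzero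
    -- elements have leading degree at least `2`.
    · obtain ⟨i, hi⟩ := hcover v₀
      have hcomp : ({v | v ≠ v₀} : Finset V).card = 1 := by
        have h1 := hcard i
        have h2 := Finset.card_le_univ (B i)
        rw [Finset.filter_ne', Finset.card_erase_of_mem (Finset.mem_univ _), Finset.card_univ]
        omega
      obtain ⟨u, hu⟩ := Finset.card_eq_one.mp hcomp
      have hset : {v | v ≠ v₀} = ({u} : Set V) := by
        rw [← Finset.coe_singleton, ← hu]
        simp
      have hf := mem_coordIdeal_of_degree_eq_blockExp m (hcard i) (hhom i) (hdeg i) hv₀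
      rw [coordIdeal, hset, Set.image_singleton, Ideal.mem_span_singleton] at hf
      obtain ⟨g, hg⟩ := hf
      have hf0 : f i ≠ 0 := (hmonic i).ne_zero
      have hX0 : (X u : MvPolynomial V K) ≠ 0 := X_ne_zero u
      have hg0 : g ≠ 0 := by
        rintro rfl
        exact hf0 (by rw [hg, mul_zero])
      have hbig : ∀ p ∈ I.toIdeal, p ≠ 0 → 2 ≤ (m.degree p).degree := by
        intro p hp hp0
        obtain ⟨j, hj⟩ := exists_le_degree_of_mem hin hp hp0
        have := Finsupp.degree_mono hj
        rw [blockExp_degree] at this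
        exact (hcard j).trans this
      have hsum : 1 + (m.degree g).degree = (B i).card := by
        have := congrArg Finsupp.degree (hdeg i)
        rwa [hg, m.degree_mul hX0 hg0, m.degree_X, map_add, Finsupp.degree_single,
          blockExp_degree] at this
      rcases hprime.mem_or_mem (hg ▸ hmem i) with h | h
      · have := hbig _ h hX0
        rw [m.degree_X, Finsupp.degree_single] at this
        omega
      · have h1 := hbig _ h hg0
        have h2 := Finset.card_le_univ (B i)
        omega

end Singularity

/-! ### Relations between the members of a regular sequence. -/

section RegularSequences

variable {R : Type*} [CommRing R]

theorem mem_span_of_sum_mul_eq_zero {f : ℕ → R} (n : ℕ)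
    (hf : ∀ k < n, ∀ h, f k * h ∈ Ideal.span (f '' (Finset.range k : Set ℕ)) →
      h ∈ Ideal.span (f '' (Finset.range k : Set ℕ)))
    {a : ℕ → R} (ha : ∑ i ∈ Finset.range n, a i * f i = 0) :
    ∀ i < n, a i ∈ Ideal.span (f '' (Finset.range n : Set ℕ)) := by
  induction n generalizing a with
  | zero => exact fun i hi => absurd hi (Nat.not_lt_zero i)
  | succ n ih =>
    have hle : Ideal.span (f '' (Finset.range n : Set ℕ)) ≤
        Ideal.span (f '' (Finset.range (n + 1) : Set ℕ)) :=
      Ideal.span_mono (Set.image_mono (by simp))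
    rw [Finset.sum_range_succ] at ha
    have hn : a n ∈ Ideal.span (f '' (Finset.range n : Set ℕ)) := by
      refine hf n (Nat.lt_succ_self n) _ ?_
      rw [mul_comm, eq_neg_of_add_eq_zero_right ha]
      exact neg_mem (sum_mem fun i hi =>
        Ideal.mul_mem_left _ _ (Ideal.subset_span (Set.mem_image_of_mem f hi)))
    obtain ⟨b', hb'⟩ := (Submodule.mem_span_image_finset_iff_exists_fun R).mp hn
    obtain ⟨b, hb⟩ : ∃ b : ℕ → R, ∑ i ∈ Finset.range n, b i • f i = a n := by
      refine ⟨fun i => if h : i ∈ Finset.range n then b' ⟨i, h⟩ else 0, ?_⟩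
      rw [← hb', ← Finset.sum_coe_sort]
      exact Finset.sum_congr rfl fun i _ => by simp
    -- Substituting `a n = ∑ b i * f i` gives a shorter relation, whose coefficients differ from the
    -- `a i` by multiples of `f n`.
    have h0 : ∑ i ∈ Finset.range n, (a i + b i * f n) * f i = 0 := by
      rw [← ha, ← hb, Finset.sum_mul, ← Finset.sum_add_distrib]
      refine Finset.sum_congr rfl fun i _ => ?_
      rw [smul_eq_mul]
      ring
    intro i hi
    rcases Nat.lt_succ_iff_lt_or_eq.mp hi with hi | rfl
    · have h1 := hle (ih (fun k hk => hf k (hk.trans (Nat.lt_succ_self n))) h0 i hi)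
      refine (Submodule.add_mem_iff_left _ (Ideal.mul_mem_left _ _ ?_)).mp h1
      exact Ideal.subset_span (Set.mem_image_of_mem f (by simp))
    · exact hle hn

/-- The coefficients of a linear relation between the elements of a weakly regular sequence lie in
the ideal generated by the sequence. -/
theorem mem_ofList_of_sum_mul_eq_zero {rs : List R}
    (hrs : RingTheory.Sequence.IsWeaklyRegular R rs) {a : Fin rs.length → R}
    (ha : ∑ i, a i * rs[i] = 0) (i : Fin rs.length) : a i ∈ Ideal.ofList rs := by
  set f : ℕ → R := fun k => rs.getD k 0 with hfdef
  have htake : ∀ k ≤ rs.length,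
      f '' (Finset.range k : Set ℕ) = {r | r ∈ rs.take k} := by
    intro k hk
    ext r
    simp only [Finset.coe_range, Set.mem_image, Set.mem_Iio, Set.mem_ofPred_eq,
      List.mem_take_iff_getElem, hfdef]
    constructor
    · rintro ⟨j, hj, rfl⟩
      exact ⟨j, by omega, (List.getD_eq_getElem _ _ (by omega)).symm⟩
    · rintro ⟨j, hj, rfl⟩
      exact ⟨j, by omega, List.getD_eq_getElem _ _ (by omega)⟩
  have hspan : Ideal.ofList rs = Ideal.span (f '' (Finset.range rs.length : Set ℕ)) := by
    rw [htake _ le_rfl, List.take_length]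
  rw [hspan]
  have := mem_span_of_sum_mul_eq_zero (f := f) rs.length
    (a := fun k => if h : k < rs.length then a ⟨k, h⟩ else 0) ?_ ?_ i i.2
  · simpa using this
  · intro k hk h hh
    have h1 := hrs.regular_mod_prev k hk
    rw [isSMulRegular_quotient_iff_mem_of_smul_mem, smul_eq_mul, Ideal.mul_top] at h1
    rw [htake k hk.le] at hh ⊢
    refine h1 h ?_
    change rs.getD k 0 * h ∈ _ at hh
    rwa [List.getD_eq_getElem _ _ hk] at hh
  · rw [← ha, Finset.sum_range]
    refine Finset.sum_congr rfl fun j _ => ?_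
    simp [hfdef]

theorem map_eq_one_of_map_sub_one {S n : Type*} [CommRing S] [DecidableEq n] (ε : R →+* S)
    {M : Matrix n n R} (h : ∀ i j, ε ((M - 1 : Matrix n n R) i j) = 0) : M.map ε = 1 := by
  ext i j
  have h1 := h i j
  rw [Matrix.sub_apply, map_sub, sub_eq_zero] at h1
  rw [Matrix.map_apply, h1, Matrix.one_apply, Matrix.one_apply, apply_ite ε, map_one, map_zero]

/-- Let an ideal be generated by a weakly regular sequence and also by a family whose linear
relations have their coefficients in the kernel of a map to a field. Then the coefficients of these
relations lie in the ideal. -/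
theorem mem_of_sum_mul_eq_zero_of_isWeaklyRegular {k ι : Type*} [Field k] [Fintype ι]
    (ε : R →+* k) {rs : List R} (hrs : RingTheory.Sequence.IsWeaklyRegular R rs) {g : ι → R}
    (hspan : Ideal.ofList rs = Ideal.span (Set.range g)) (hε : Ideal.ofList rs ≤ RingHom.ker ε)
    (hrel : ∀ c : ι → R, ∑ j, c j * g j = 0 → ∀ j, ε (c j) = 0)
    {c : ι → R} (hc : ∑ j, c j * g j = 0) (j : ι) : c j ∈ Ideal.ofList rs := by
  classical
  set J := Ideal.ofList rs with hJ
  have hr : ∀ i : Fin rs.length, ∃ a : ι → R, ∑ j, a j * g j = rs[i] := fun i =>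
    Ideal.mem_span_range_iff_exists_fun.mp (hspan ▸ Ideal.subset_span (List.getElem_mem i.2))
  choose A hA using hr
  have hrange : Set.range (fun i : Fin rs.length => rs[i]) = {r | r ∈ rs} := by
    ext r
    simp only [Set.mem_range, Set.mem_ofPred_eq, List.mem_iff_get]
    rfl
  have hg : ∀ j, ∃ b : Fin rs.length → R, ∑ i, b i * rs[i] = g j := fun j => by
    refine Ideal.mem_span_range_iff_exists_fun.mp ?_
    rw [hrange]
    change g j ∈ J
    rw [hspan]
    exact Ideal.subset_span ⟨j, rfl⟩
  choose B hB using hg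
  let MA : Matrix (Fin rs.length) ι R := Matrix.of A
  let MB : Matrix ι (Fin rs.length) R := Matrix.of B
  have hAB : ∀ i l, (MA * MB - 1 : Matrix _ _ R) i l ∈ J := by
    intro i
    refine mem_ofList_of_sum_mul_eq_zero hrs ?_
    simp only [Matrix.sub_apply, sub_mul, Finset.sum_sub_distrib, Matrix.mul_apply, Finset.sum_mul,
      Matrix.one_apply, ite_mul, one_mul, zero_mul, Finset.sum_ite_eq, Finset.mem_univ, if_true]
    rw [Finset.sum_comm, sub_eq_zero, ← hA i]
    refine Finset.sum_congr rfl fun j _ => ?_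
    rw [← hB j, Finset.mul_sum]
    exact Finset.sum_congr rfl fun l _ => mul_assoc _ _ _
  have hBA : ∀ j l, ε ((MB * MA - 1 : Matrix _ _ R) j l) = 0 := by
    intro j
    refine hrel _ ?_
    simp only [Matrix.sub_apply, sub_mul, Finset.sum_sub_distrib, Matrix.mul_apply, Finset.sum_mul,
      Matrix.one_apply, ite_mul, one_mul, zero_mul, Finset.sum_ite_eq, Finset.mem_univ, if_true]
    rw [Finset.sum_comm, sub_eq_zero, ← hB j]
    refine Finset.sum_congr rfl fun i _ => ?_
    rw [← hA i, Finset.mul_sum]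
    exact Finset.sum_congr rfl fun l _ => mul_assoc _ _ _
  -- Over the field the two transition matrices are mutually inverse, so both generating families
  -- have the same number of members.
  have hABk : MA.map ε * MB.map ε = 1 := by
    rw [← Matrix.map_mul]
    exact map_eq_one_of_map_sub_one ε fun i l => RingHom.mem_ker.mp (hε (hAB i l))
  have hBAk : MB.map ε * MA.map ε = 1 := by
    rw [← Matrix.map_mul]
    exact map_eq_one_of_map_sub_one ε hBA
  have hcard : Fintype.card (Fin rs.length) = Fintype.card ι :=
    Matrix.square_of_invertible _ _ hABk hBAk
  set π := Ideal.Quotient.mk J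
  have hABq : MA.map π * MB.map π = 1 := by
    rw [← Matrix.map_mul]
    exact map_eq_one_of_map_sub_one π fun i l => Ideal.Quotient.eq_zero_iff_mem.mpr (hAB i l)
  -- For equal sizes a one-sided inverse over the commutative ring `R ⧸ J` is two-sided. A relation
  -- `c` satisfies `c * MB = 0` modulo `J`, so `c = c * MB * MA = 0` there.
  have hBAq : MB.map π * MA.map π = 1 := (Matrix.mul_eq_one_comm_of_card_eq _ _ _ hcard).mp hABq
  have hcB : Matrix.vecMul (fun j => π (c j)) (MB.map π) = 0 := by
    ext i
    have h1 : ∑ i, (∑ j, c j * B j i) * rs[i] = 0 := by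
      rw [← hc]
      simp only [Finset.sum_mul]
      rw [Finset.sum_comm]
      refine Finset.sum_congr rfl fun j _ => ?_
      rw [← hB j, Finset.mul_sum]
      exact Finset.sum_congr rfl fun l _ => mul_assoc _ _ _
    have h2 := Ideal.Quotient.eq_zero_iff_mem.mpr (mem_ofList_of_sum_mul_eq_zero hrs h1 i)
    rw [map_sum] at h2
    simpa [Matrix.vecMul, dotProduct, MB, π] using h2
  have h3 : (fun j => π (c j)) = 0 := by
    rw [← Matrix.vecMul_one (fun j => π (c j)), ← hBAq, ← Matrix.vecMul_vecMul, hcB,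
      Matrix.zero_vecMul]
  exact Ideal.Quotient.eq_zero_iff_mem.mp (congrFun h3 j)

end RegularSequences

/-! ### Minimal nonfaces and complete intersections. -/

section StanleyReisner

variable {V K : Type*} [Field K]

theorem blockExp_le_blockExp_iff {F G : Finset V} : blockExp F ≤ blockExp G ↔ F ⊆ G := by
  classical
  rw [blockExp_le_iff]
  refine forall₂_congr fun v _ => ?_
  rw [blockExp_apply]
  split_ifs with h <;> simp [h]

theorem stanleyReisnerIdeal_eq_span {ι : Type*} {D : PreAbstractSimplicialComplex V}
    {B : ι → Finset V} (hne : ∀ i, (B i).Nonempty) (hB : ∀ i, B i ∉ D.faces)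
    (hD : ∀ F : Finset V, F.Nonempty → F ∉ D.faces → ∃ i, B i ⊆ F) :
    stanleyReisnerIdeal K D = Ideal.span (Set.range fun i => monomial (blockExp (B i)) 1) := by
  classical
  apply le_antisymm
  · refine Ideal.span_le.mpr ?_
    rintro _ ⟨F, hF, hFD, rfl⟩
    obtain ⟨i, hi⟩ := hD F hF hFD
    rw [SetLike.mem_coe, ← Finset.prod_sdiff hi, ← monomial_blockExp (B i)]
    exact Ideal.mul_mem_left _ _ (Ideal.subset_span ⟨i, rfl⟩)
  · refine Ideal.span_mono ?_
    rintro _ ⟨i, rfl⟩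
    exact ⟨B i, hne i, hB i, monomial_blockExp _⟩

theorem exists_isMinimalNonface_subset (D : PreAbstractSimplicialComplex V) {F : Finset V}
    (hF : F.Nonempty) (hFD : F ∉ D.faces) : ∃ G ⊆ F, IsMinimalNonface D G :=
  exists_minimal_le_of_wellFoundedLT (fun G : Finset V => G.Nonempty ∧ G ∉ D.faces) F ⟨hF, hFD⟩

theorem stanleyReisnerIdeal_eq_span_isMinimalNonface (D : PreAbstractSimplicialComplex V) :
    stanleyReisnerIdeal K D =
      Ideal.span (Set.range fun F : {F // IsMinimalNonface D F} => monomial (blockExp F.1) 1) :=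
  stanleyReisnerIdeal_eq_span (fun F => F.2.prop.1) (fun F => F.2.prop.2) fun F hF hFD => by
    obtain ⟨G, hGF, hG⟩ := exists_isMinimalNonface_subset D hF hFD
    exact ⟨⟨G, hG⟩, hGF⟩

/-- The minimal nonfaces of a complete intersection complex are pairwise disjoint. -/
theorem disjoint_of_isCompleteIntersection [Finite V] {D : PreAbstractSimplicialComplex V}
    (hCI : IsCompleteIntersection (stanleyReisnerIdeal K D)) {F G : Finset V}
    (hF : IsMinimalNonface D F) (hG : IsMinimalNonface D G) (hne : F ≠ G) : Disjoint F G := by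
  classical
  obtain ⟨rs, hreg, hrs⟩ := hCI
  have := Fintype.ofFinite {F // IsMinimalNonface D F}
  have heq : ∀ {F G : Finset V}, IsMinimalNonface D F → IsMinimalNonface D G → F ⊆ G → F = G :=
    fun hF hG h => h.antisymm (hG.le_of_le hF.prop h)
  set g : {F // IsMinimalNonface D F} → MvPolynomial V K := fun F => monomial (blockExp F.1) 1
  have hspan : Ideal.ofList rs = Ideal.span (Set.range g) := by
    rw [hrs, stanleyReisnerIdeal_eq_span_isMinimalNonface]
  let jF : {F // IsMinimalNonface D F} := ⟨F, hF⟩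
  let jG : {F // IsMinimalNonface D F} := ⟨G, hG⟩
  have hjne : jF ≠ jG := fun h => hne (congrArg Subtype.val h)
  -- This is the syzygy between the monomials of `F` and `G`. Its coefficient, the monomial of `G \
  -- F`, must lie in the ideal, so `G \ F` contains a minimal nonface; by minimality that is `G`
  -- itself.
  let c : {F // IsMinimalNonface D F} → MvPolynomial V K :=
    Pi.single jF (monomial (blockExp (G \ F)) 1) -
      Pi.single jG (monomial (blockExp (F \ G)) 1)
  have hc : ∑ j, c j * g j = 0 := by
    simp only [c, Pi.sub_apply, sub_mul, Finset.sum_sub_distrib, Pi.single_apply, ite_mul, zero_mul,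
      Finset.sum_ite_eq', Finset.mem_univ, if_true, g, monomial_mul, one_mul]
    rw [sub_eq_zero, blockExp, blockExp, blockExp, blockExp,
      ← Finset.sum_union Finset.sdiff_disjoint, ← Finset.sum_union Finset.sdiff_disjoint,
      Finset.sdiff_union_self_eq_union, Finset.sdiff_union_self_eq_union, Finset.union_comm]
  have hmem := mem_of_sum_mul_eq_zero_of_isWeaklyRegular (constantCoeff (R := K) (σ := V))
    hreg.toIsWeaklyRegular hspan ?_ ?_ hc jF
  · have hcF : c jF = monomial (blockExp (G \ F)) 1 := by
      simp [c, hjne]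
    rw [hcF, hspan, Set.range_comp' (fun d => (monomial d 1 : MvPolynomial V K))
      (fun F : {F // IsMinimalNonface D F} => blockExp F.1), mem_ideal_span_monomial_image] at hmem
    obtain ⟨_, ⟨⟨E, hE⟩, rfl⟩, hle⟩ := hmem (blockExp (G \ F)) (by simp [mem_support_iff])
    have hEG := blockExp_le_blockExp_iff.mp hle
    have := heq hE hG (hEG.trans Finset.sdiff_subset)
    subst this
    exact Finset.disjoint_right.mpr fun v hv => (Finset.mem_sdiff.mp (hEG hv)).2
  · rw [hspan, Ideal.span_le]
    rintro _ ⟨⟨E, hE⟩, rfl⟩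
    rw [SetLike.mem_coe, RingHom.mem_ker, constantCoeff_monomial, if_neg]
    intro h
    have := blockExp_degree E
    rw [h, map_zero] at this
    exact hE.prop.1.card_pos.ne this
  -- The generators are incomparable monomials, so the coefficient of the relation at the `j`-th one
  -- is the constant term of `c j`.
  · intro c hc j
    have h := congrArg (coeff (blockExp j.1)) hc
    rw [coeff_sum, coeff_zero, Finset.sum_eq_single j] at h
    · rw [coeff_mul_monomial', if_pos le_rfl, tsub_self, mul_one] at h
      exact h
    · intro l _ hl
      rw [coeff_mul_monomial', if_neg]
      intro hle
      exact hl (Subtype.ext (heq l.2 j.2 (blockExp_le_blockExp_iff.mp hle)))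
    · exact fun h => absurd (Finset.mem_univ j) h

end StanleyReisner

/-! ### Joins of boundaries of simplices. -/

section Joins

variable {ι : Type*} {α : ι → Type*} [∀ i, Fintype (α i)]

/-- The vertices of the `i`-th simplex of a join of simplices. -/
def joinBlock (α : ι → Type*) [∀ i, Fintype (α i)] (i : ι) : Finset (Σ i, α i) :=
  Finset.univ.map (Function.Embedding.sigmaMk i)

theorem mem_joinBlock {i : ι} {v : Σ i, α i} : v ∈ joinBlock α i ↔ v.1 = i := by
  rw [joinBlock, Finset.mem_map]
  constructor
  · rintro ⟨a, -, rfl⟩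
    rfl
  · rintro rfl
    exact ⟨v.2, Finset.mem_univ _, rfl⟩

theorem pairwise_disjoint_joinBlock :
    Pairwise fun i j => Disjoint (joinBlock α i) (joinBlock α j) := fun _ _ hij =>
  Finset.disjoint_left.mpr fun _ hv hv' => hij ((mem_joinBlock.mp hv).symm.trans (mem_joinBlock.mp hv'))

theorem card_joinBlock (i : ι) : (joinBlock α i).card = Fintype.card (α i) := by
  rw [joinBlock, Finset.card_map, Finset.card_univ]

theorem two_le_card_joinBlock [∀ i, Nontrivial (α i)] (i : ι) : 2 ≤ (joinBlock α i).card := by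
  rw [card_joinBlock]
  exact Fintype.one_lt_card

theorem blockExp_joinBlock (i : ι) :
    blockExp (joinBlock α i) = ∑ a : α i, Finsupp.single ⟨i, a⟩ 1 := by
  rw [blockExp, joinBlock, Finset.sum_map]
  rfl

theorem stanleyReisnerIdeal_join_simplexBoundary (K : Type*) [Field K] [∀ i, Nontrivial (α i)] :
    GroebnerSmoothing.stanleyReisnerIdeal K
        (GroebnerSmoothing.join fun i => GroebnerSmoothing.simplexBoundary (α i)) =
      Ideal.span (Set.range fun i => monomial (blockExp (joinBlock α i)) 1) := by
  refine stanleyReisnerIdeal_eq_span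
    (fun i => Finset.card_pos.mp (by have := two_le_card_joinBlock (α := α) i; omega)) ?_ ?_
  · rintro i ⟨-, h⟩
    have huniv : GroebnerSmoothing.block (joinBlock α i) i = Finset.univ := by
      ext a
      simp [GroebnerSmoothing.block, mem_joinBlock]
    rcases h i with h | h
    · rw [huniv] at h
      exact Finset.univ_nonempty.ne_empty h
    · exact h.2 huniv
  · intro F hF hFD
    have h : ∃ i, ¬ (GroebnerSmoothing.block F i = ∅ ∨
        GroebnerSmoothing.block F i ∈ (GroebnerSmoothing.simplexBoundary (α i)).faces) := by
      by_contra! hall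
      exact hFD ⟨hF, hall⟩
    obtain ⟨i, hi⟩ := h
    rw [not_or] at hi
    refine ⟨i, fun v hv => ?_⟩
    obtain ⟨j, a⟩ := v
    obtain rfl : j = i := mem_joinBlock.mp hv
    have huniv : GroebnerSmoothing.block F j = Finset.univ := by
      by_contra hne
      exact hi.2 ⟨Finset.nonempty_iff_ne_empty.mpr hi.1, hne⟩
    have ha : a ∈ GroebnerSmoothing.block F j := huniv ▸ Finset.mem_univ a
    simpa [GroebnerSmoothing.block] using ha

end Joins

/-! ### The three statements. -/

theorem mainTheorem6 (K : Type uK) [Field K] :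
    (∀ (ι : Type uI) [Fintype ι] (α : ι → Type uA) [∀ i, Fintype (α i)] [∀ i, Nontrivial (α i)],
      ¬ GroebnerSmoothing.IsGroebnerSmoothable.{max uI uA, uK, w} K
          (GroebnerSmoothing.join fun i => GroebnerSmoothing.simplexBoundary (α i))) ∧
    (∀ (V : Type uV) [Fintype V] (D : AbstractSimplicialComplex V),
      GroebnerSmoothing.IsCompleteIntersection
        (GroebnerSmoothing.stanleyReisnerIdeal K D.toPreAbstractSimplicialComplex) →
      (∀ v : V, ∃ F : Finset V, v ∈ F ∧
        GroebnerSmoothing.IsMinimalNonface D.toPreAbstractSimplicialComplex F) →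
      ¬ GroebnerSmoothing.IsGroebnerSmoothable.{uV, uK, w} K
          D.toPreAbstractSimplicialComplex) ∧
    (∀ (ι : Type uI) [Fintype ι] (α : ι → Type uA) [∀ i, Fintype (α i)] [∀ i, Nontrivial (α i)],
      2 < Fintype.card (Σ i, α i) →
      ∀ (m : MonomialOrder.{max uI uA, w} (Σ i, α i)) (f : ι → MvPolynomial (Σ i, α i) K)
        (I : HomogeneousIdeal (homogeneousSubmodule (Σ i, α i) K)),
        (∀ i, (f i).IsHomogeneous (Fintype.card (α i))) →
        (∀ i, m.degree (f i) = ∑ a : α i, Finsupp.single ⟨i, a⟩ 1) →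
        GroebnerSmoothing.IsReducedGroebnerBasis m (Set.range f) I.toIdeal →
        ∀ v₀ : Σ i, α i, (∀ v, Finsupp.single v 1 ≼[m] Finsupp.single v₀ 1) →
          ∃ y : GroebnerSmoothing.projScheme I,
            GroebnerSmoothing.pointIdeal I y = Ideal.span (X '' {v | v ≠ v₀}) ∧
            ¬ GroebnerSmoothing.IsNonsingularAt (GroebnerSmoothing.projScheme I) y) := by
  refine ⟨?_, ?_, ?_⟩
  · rintro ι _ α _ _ ⟨I, m, hprime, hne, hsmooth, hin⟩
    rw [stanleyReisnerIdeal_join_simplexBoundary] at hin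
    exact not_smooth_of_initialIdeal_eq pairwise_disjoint_joinBlock
      (fun v => ⟨v.1, mem_joinBlock.mpr rfl⟩) two_le_card_joinBlock I hprime hne hsmooth hin
  · rintro V _ D hCI hcover ⟨I, m, hprime, hne, hsmooth, hin⟩
    rw [stanleyReisnerIdeal_eq_span_isMinimalNonface] at hin
    have := Fintype.ofFinite
      {F // GroebnerSmoothing.IsMinimalNonface D.toPreAbstractSimplicialComplex F}
    refine not_smooth_of_initialIdeal_eq (fun F G hFG => ?_) (fun v => ?_) (fun F => ?_)
      I hprime hne hsmooth hin
    · exact disjoint_of_isCompleteIntersection hCI F.2 G.2 fun h => hFG (Subtype.ext h)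
    · obtain ⟨F, hv, hF⟩ := hcover v
      exact ⟨⟨F, hF⟩, hv⟩
    · obtain ⟨F, hF⟩ := F
      change 2 ≤ F.card
      have h1 := hF.prop.1.card_pos
      by_contra hlt
      obtain ⟨v, rfl⟩ := Finset.card_eq_one.mp (by omega : F.card = 1)
      -- Singletons are faces, so a minimal nonface has at least two elements.
      exact hF.prop.2 (D.singleton_mem v)
  · intro ι _ α _ _ hV m f I hhom hdeg hG v₀ hmax
    simp only [← blockExp_joinBlock, ← card_joinBlock] at hdeg hhom
    have hin : GroebnerSmoothing.initialIdeal m I.toIdeal =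
        Ideal.span (Set.range fun i => monomial (blockExp (joinBlock α i)) 1) := by
      rw [← hG.span_leadingTerm, ← Set.range_comp]
      congr 2
      ext1 i
      rw [Function.comp_apply, MonomialOrder.leadingTerm, hdeg,
        (hG.monic _ ⟨i, rfl⟩).leadingCoeff_eq_one]
    refine exists_singular_coordinate_point pairwise_disjoint_joinBlock
      (fun v => ⟨v.1, mem_joinBlock.mpr rfl⟩) two_le_card_joinBlock I hV
      (fun i => hG.subset ⟨i, rfl⟩) (fun i => hG.monic _ ⟨i, rfl⟩) hdeg hin hhom ?_ hmax
    intro i j hij d hd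
    rw [← hdeg j]
    refine hG.reduced _ ⟨i, rfl⟩ _ ⟨j, rfl⟩ (fun h => ?_) d hd
    obtain ⟨a⟩ : Nonempty (α i) := inferInstance
    have h1 : (⟨i, a⟩ : Σ i, α i) ∈ joinBlock α j := by
      refine blockExp_le_blockExp_iff.mp ?_ (mem_joinBlock.mpr (rfl : (⟨i, a⟩ : Σ i, α i).1 = i))
      rw [← hdeg i, ← hdeg j, h]
    exact hij (mem_joinBlock.mp h1)
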